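/- Let $d\in\mathbb N$ and let $\mathcal H=L^2(\mathbb R^d)$ (Lebesgue measure) or $\mathcal H=\ell^2(\mathbb Z^d)$. For $x\in\mathbb R^d$ put $|x|=\max_i|x_i|$; for $u\in\mathbb Z^d$ let $\chi_u$ be multiplication by the characteristic function of the open box of side length $1$ centered at $u$ (in the lattice case, of $\{u\}$), and let $|X_u|$ be multiplication by $|x-u|$. Write $\|\cdot\|_2$ for the Hilbert–Schmidt norm ($+\infty$ if the operator is not Hilbert–Schmidt). Let $H$ be a (possibly unbounded) self-adjoint operator on $\mathcal H$, $P_E=\chi_{\{E\}}(H)$ for $E\in\mathbb R$, and for an open interval $I$ let $C^\infty_{c,+}(I)$ be the set of nonnegative smooth functions on $\mathbb R$ with compact support contained in $I$. For $\sigma>0$, $\zeta\in(0,1]$, $\mathcal X\in C^\infty_{c,+}(I)$, $t\in\mathbb R$, $u\in\mathbb Z^d$ set $$M_u(\sigma,\zeta,\mathcal X,t)=\big\|e^{\frac\sigma2|X_u|^\zeta}e^{-itH}\mathcal X(H)\chi_u\big\|_2^2\in[0,\infty].$$ **Theorem.** Let $I\subset\sigma(H)$ be an open interval and assume that $H$ has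 pure point spectrum in $I$. In the case $\mathcal H=L^2(\mathbb R^d)$ assume moreover that for some $\kappa>d/2$, with $T$ the multiplication by $(1+|x|^2)^{\kappa/2}$, $$\sum_{E\in J}\operatorname{tr}\big(T^{-1}P_ET^{-1}\big)=\sum_{E\in J}\|T^{-1}P_E\|_2^2<\infty\qquad\text{for every compact }J\subset I$$ (only eigenvalues $E$ contribute to the sum); no such assumption is made for $\ell^2(\mathbb Z^d)$. Then the following properties are equivalent, where the constants $C<\infty$ do not depend on $u,x\in\mathbb Z^d$. (i) There exist $\sigma>0$, $\zeta\in(0,1]$ such that for all $\epsilon>0$ and $\mathcal X\in C^\infty_{c,+}(I)$ there is $C=C_{\sigma,\zeta,\epsilon,\mathcal X}$ with $$\sup_{T>0}\frac1T\int_0^TM_u(\sigma,\zeta,\mathcal X,t)\,dt\le C\,e^{\epsilon|u|^\zeta}\quad\text{for all }u\in\mathbb Z^d.$$ (ii) There exist $\sigma>0$, $\zeta\in(0,1]$ such that for all $\epsilon>0$ and $\mathcal X\in C^\infty_{c,+}(I)$ there is $C=C_{\sigma,\zeta,\epsilon,\mathcal X}$ with $$\sup_{T>0}\frac1T\int_0^\infty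 e^{-t/T}M_u(\sigma,\zeta,\mathcal X,t)\,dt\le C\,e^{\epsilon|u|^\zeta}\quad\text{for all }u\in\mathbb Z^d.$$ (iii) There exist $\sigma>0$, $\zeta\in(0,1]$ such that for all $\epsilon>0$ and $\mathcal X\in C^\infty_{c,+}(I)$ there is $C=C_{\sigma,\zeta,\epsilon,\mathcal X}$ with $$\sup_{t\in\mathbb R}M_u(\sigma,\zeta,\mathcal X,t)\le C\,e^{\epsilon|u|^\zeta}\quad\text{for all }u\in\mathbb Z^d.$$ (iv) (SUDL) There exist $\zeta\in(0,1]$, $\sigma>0$ such that for all $\epsilon>0$ and $\mathcal X\in C^\infty_{c,+}(I)$ there is $C=C_{\zeta,\sigma,\epsilon,\mathcal X}$ with $$\sup_{t\in\mathbb R}\|\chi_xe^{-itH}\mathcal X(H)\chi_u\|_2\le C\,e^{\epsilon|u|^\zeta}e^{-\sigma|x-u|^\zeta}\quad\text{for all }x,u\in\mathbb Z^d.$$ (v) (SULP) There exist $\zeta\in(0,1]$, $\sigma>0$ such that for all $\epsilon>0$ and $\mathcal X\in C^\infty_{c,+}(I)$ there is $C=C_{\zeta,\sigma,\epsilon,\mathcal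 X}$ with $$\sup_{E\in\mathbb R}\mathcal X(E)\|\chi_xP_E\chi_u\|_2\le C\,e^{\epsilon|u|^\zeta}e^{-\sigma|x-u|^\zeta}\quad\text{for all }x,u\in\mathbb Z^d.$$ -/

import Mathlib

open MeasureTheory
open scoped ENNReal

namespace DynLoc

noncomputable section

/-! ### Hilbert-Schmidt norms and self-adjoint operators on a Hilbert space -/

section Abstract

variable {E : Type*} [NormedAddCommGroup E] [InnerProductSpace ℂ E] [CompleteSpace E]

/-- The index set of an orthonormal (Hilbert) basis of `E`. -/
def basisIndex (E : Type*) [NormedAddCommGroup E] [InnerProductSpace ℂ E] [CompleteSpace E] :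
    Set E :=
  Classical.choose (exists_hilbertBasis ℂ E)

/-- An orthonormal (Hilbert) basis of `E`. -/
def basis (E : Type*) [NormedAddCommGroup E] [InnerProductSpace ℂ E] [CompleteSpace E] :
    HilbertBasis (basisIndex E) ℂ E :=
  Classical.choose (Classical.choose_spec (exists_hilbertBasis ℂ E))

/-- The Hilbert-Schmidt norm `‖A‖₂ = (∑ᵢ ‖A bᵢ‖²)^{1/2}`, with value `∞` if `A` is not
Hilbert-Schmidt. -/
def hsNorm (A : E →L[ℂ] E) : ℝ≥0∞ :=
  (∑' i, ‖A (basis E i)‖ₑ ^ 2) ^ (1 / 2 : ℝ)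

/-- The part of the spectrum of the (possibly unbounded) operator `H` on the real line: those real
`lam` for which `H - lam` is not a bijection from the domain of `H` onto the whole space. For a
self-adjoint operator this is the whole spectrum. -/
def realSpectrum (H : E →ₗ.[ℂ] E) : Set ℝ :=
  {lam | ¬ Function.Bijective fun ψ : H.domain => H ψ - (lam : ℂ) • (ψ : E)}

/-- The space of `ψ` in the domain of `H` such that `H ψ = lam ψ`. -/
def eigenspace (H : E →ₗ.[ℂ] E) (lam : ℝ) : Submodule ℂ E :=
  (LinearMap.ker (H.toFun - (lam : ℂ) • H.domain.subtype)).map H.domain.subtype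

/-- The projection `P_lam = χ_{lam}(H)` for self-adjoint `H`: the orthogonal projection onto the
eigenspace (which is closed, since `H` is closed); it is `0` if `lam` is not an eigenvalue. -/
def eigenProj (H : E →ₗ.[ℂ] E) (lam : ℝ) : E →L[ℂ] E :=
  (eigenspace H lam).topologicalClosure.starProjection

/-- `R` is a bounded two-sided inverse of `H - z`. -/
def IsResolventAt (H : E →ₗ.[ℂ] E) (z : ℂ) (R : E →L[ℂ] E) : Prop :=
  (∀ ψ : E, ∃ h : R ψ ∈ H.domain, H ⟨R ψ, h⟩ - z • R ψ = ψ) ∧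
    ∀ φ : H.domain, R (H φ - z • (φ : E)) = φ

open Classical in
/-- The resolvent `(H - z)⁻¹` (and `0` if `H - z` has no bounded inverse, which does not happen for
self-adjoint `H` and non-real `z`). -/
def resolventAt (H : E →ₗ.[ℂ] E) (z : ℂ) : E →L[ℂ] E :=
  if h : ∃ R, IsResolventAt H z R then Classical.choose h else 0

/-- The operator `f(H)` for self-adjoint `H` and a continuous `f` that vanishes at infinity. It is
the continuous function `1 / (lam + i) ↦ f lam`, `0 ↦ 0` of the bounded normal operator
`(H + i)⁻¹`, whose spectrum is contained in `{1 / (lam + i) : lam ∈ ℝ} ∪ {0}`. -/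
def funCalc (H : E →ₗ.[ℂ] E) (f : ℝ → ℂ) : E →L[ℂ] E :=
  cfc (fun z : ℂ => if z = 0 then 0 else f (z⁻¹).re) (resolventAt H (-Complex.I))

/-- The operator `e^{-itH} X(H)`, for `X` continuous with compact support. -/
def evol (H : E →ₗ.[ℂ] E) (X : ℝ → ℝ) (t : ℝ) : E →L[ℂ] E :=
  funCalc H fun lam => Complex.exp (-(Complex.I * t * lam)) * X lam

/-- The range of the spectral projection `χ_I(H)` of an open set `I`: as `χ_I(H)` is the strong
limit of `f(H)` along continuous compactly supported `0 ≤ f ↑ χ_I`, it is the closed linear span of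
the ranges of `f(H)`, where `f` is continuous with compact support contained in `I`. -/
def spectralSubspace (H : E →ₗ.[ℂ] E) (I : Set ℝ) : Submodule ℂ E :=
  (⨆ f ∈ {f : ℝ → ℂ | Continuous f ∧ HasCompactSupport f ∧ tsupport f ⊆ I},
    LinearMap.range (funCalc H f).toLinearMap).topologicalClosure

/-- The pure point subspace: the closed linear span of all eigenvectors of `H`. -/
def purePointSubspace (H : E →ₗ.[ℂ] E) : Submodule ℂ E :=
  (⨆ lam : ℝ, eigenspace H lam).topologicalClosure

/-- `H` has pure point spectrum in the open set `I`: there is no continuous spectrum in `I`, that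
is, the range of `χ_I(H)` is contained in the pure point subspace. -/
def HasPurePointSpectrumIn (H : E →ₗ.[ℂ] E) (I : Set ℝ) : Prop :=
  spectralSubspace H I ≤ purePointSubspace H

end Abstract

/-- The class of nonnegative smooth functions with compact support contained in `I`. -/
def TestFun (I : Set ℝ) : Set (ℝ → ℝ) :=
  {X | ContDiff ℝ (⊤ : ℕ∞) X ∧ HasCompactSupport X ∧ tsupport X ⊆ I ∧ ∀ x, 0 ≤ X x}

/-! ### Position space

The Hilbert space is `L²(ℝᵈ, μ)`, with `μ` the Lebesgue measure, or the counting measure of `ℤᵈ`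
(which gives `ℓ²(ℤᵈ)`). The norm of `Fin d → ℝ` is the maximum norm. -/

section Position

variable {d : ℕ}

/-- The point of `ℤᵈ` as a point of `ℝᵈ`. -/
def pt (u : Fin d → ℤ) : Fin d → ℝ := fun i => (u i : ℝ)

/-- The counting measure of `ℤᵈ`, as a measure on `ℝᵈ`. -/
def latticeMeasure (d : ℕ) : Measure (Fin d → ℝ) :=
  Measure.sum fun n : Fin d → ℤ => Measure.dirac (pt n)

/-- The Hilbert space `L²(ℝᵈ, μ)`. -/
abbrev L2 (μ : Measure (Fin d → ℝ)) : Type := Lp ℂ 2 μ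

/-- The open box of side length one centered at `u`. -/
def box (u : Fin d → ℤ) : Set (Fin d → ℝ) := Metric.ball (pt u) (1 / 2)

theorem measurableSet_box (u : Fin d → ℤ) : MeasurableSet (box u) :=
  Metric.isOpen_ball.measurableSet

variable (μ : Measure (Fin d → ℝ))

/-- `χ_u`: multiplication by the characteristic function of the unit box centered at `u`. -/
def chi (u : Fin d → ℤ) : L2 μ →L[ℂ] L2 μ :=
  LinearMap.mkContinuous
    { toFun := fun f => ((Lp.memLp f).indicator (measurableSet_box u)).toLp
      map_add' := by
        intro f g
        rw [← MemLp.toLp_add]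
        refine MemLp.toLp_congr _ _ ?_
        filter_upwards [Lp.coeFn_add f g] with x hx
        by_cases h : x ∈ box u
        · simpa [h] using hx
        · simp [h]
      map_smul' := by
        intro c f
        rw [RingHom.id_apply, ← MemLp.toLp_const_smul]
        refine MemLp.toLp_congr _ _ ?_
        filter_upwards [Lp.coeFn_smul c f] with x hx
        by_cases h : x ∈ box u
        · simpa [h] using hx
        · simp [h] }
    1
    (by
      intro f
      rw [one_mul]
      change ‖((Lp.memLp f).indicator (measurableSet_box u)).toLp‖ ≤ ‖f‖
      rw [Lp.norm_toLp, Lp.norm_def]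
      exact ENNReal.toReal_mono (Lp.eLpNorm_ne_top f) (eLpNorm_indicator_le _))

/-- `‖w(x)^{1/2} A‖₂²`, the squared Hilbert-Schmidt norm of `A` followed by multiplication by the
square root of the nonnegative function `w` (possibly unbounded; the value is `∞` if the product is
not a Hilbert-Schmidt operator). -/
def weightedHSSq (w : (Fin d → ℝ) → ℝ) (A : L2 μ →L[ℂ] L2 μ) : ℝ≥0∞ :=
  ∑' i, ∫⁻ x, ENNReal.ofReal (w x) * ‖A (basis (L2 μ) i) x‖ₑ ^ 2 ∂μ

variable (H : L2 μ →ₗ.[ℂ] L2 μ) (I : Set ℝ)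

/-- The moment `M_u(σ, ζ, X, t) = ‖e^{(σ/2)|x-u|^ζ} e^{-itH} X(H) χ_u‖₂²`. -/
def moment (u : Fin d → ℤ) (σ ζ : ℝ) (X : ℝ → ℝ) (t : ℝ) : ℝ≥0∞ :=
  weightedHSSq μ (fun x => Real.exp (σ * ‖x - pt u‖ ^ ζ)) (evol H X t ∘L chi μ u)

/-- Time averaged moments are bounded. -/
def AveragedMomentBound : Prop :=
  ∃ σ > 0, ∃ ζ ∈ Set.Ioc (0 : ℝ) 1, ∀ ε > 0, ∀ X ∈ TestFun I, ∃ C : ℝ, ∀ u : Fin d → ℤ,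
    (⨆ T : Set.Ioi (0 : ℝ),
        ENNReal.ofReal (1 / T) * ∫⁻ t in Set.Icc (0 : ℝ) T, moment μ H u σ ζ X t)
      ≤ ENNReal.ofReal (C * Real.exp (ε * ‖pt u‖ ^ ζ))

/-- Abel (exponentially weighted) time averages of the moments are bounded. -/
def AbelMomentBound : Prop :=
  ∃ σ > 0, ∃ ζ ∈ Set.Ioc (0 : ℝ) 1, ∀ ε > 0, ∀ X ∈ TestFun I, ∃ C : ℝ, ∀ u : Fin d → ℤ,
    (⨆ T : Set.Ioi (0 : ℝ),
        ENNReal.ofReal (1 / T) *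
          ∫⁻ t in Set.Ici (0 : ℝ), ENNReal.ofReal (Real.exp (-t / T)) * moment μ H u σ ζ X t)
      ≤ ENNReal.ofReal (C * Real.exp (ε * ‖pt u‖ ^ ζ))

/-- The moments are bounded uniformly in time. -/
def UniformMomentBound : Prop :=
  ∃ σ > 0, ∃ ζ ∈ Set.Ioc (0 : ℝ) 1, ∀ ε > 0, ∀ X ∈ TestFun I, ∃ C : ℝ, ∀ u : Fin d → ℤ,
    (⨆ t : ℝ, moment μ H u σ ζ X t) ≤ ENNReal.ofReal (C * Real.exp (ε * ‖pt u‖ ^ ζ))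

/-- Semi-uniform dynamical localization (SUDL). -/
def SUDL : Prop :=
  ∃ ζ ∈ Set.Ioc (0 : ℝ) 1, ∃ σ > 0, ∀ ε > 0, ∀ X ∈ TestFun I, ∃ C : ℝ, ∀ x u : Fin d → ℤ,
    (⨆ t : ℝ, hsNorm (chi μ x ∘L evol H X t ∘L chi μ u))
      ≤ ENNReal.ofReal
          (C * Real.exp (ε * ‖pt u‖ ^ ζ) * Real.exp (-σ * ‖pt x - pt u‖ ^ ζ))

/-- Semi-uniformly localized projections (SULP). -/
def SULP : Prop :=
  ∃ ζ ∈ Set.Ioc (0 : ℝ) 1, ∃ σ > 0, ∀ ε > 0, ∀ X ∈ TestFun I, ∃ C : ℝ, ∀ x u : Fin d → ℤ,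
    (⨆ lam : ℝ, ENNReal.ofReal (X lam) * hsNorm (chi μ x ∘L eigenProj H lam ∘L chi μ u))
      ≤ ENNReal.ofReal
          (C * Real.exp (ε * ‖pt u‖ ^ ζ) * Real.exp (-σ * ‖pt x - pt u‖ ^ ζ))

/-- The local finiteness condition: for some `κ > d / 2` and with `T` the multiplication by
`(1 + |x|²)^{κ/2}`, the sum of `tr (T⁻¹ P_E T⁻¹) = ‖T⁻¹ P_E‖₂²` over the eigenvalues `E` in any
compact subset of `I` is finite. (Only eigenvalues contribute to the sum over `J`.) -/
def LocallyTraceFinite : Prop :=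
  ∃ κ : ℝ, (d : ℝ) / 2 < κ ∧ ∀ J : Set ℝ, IsCompact J → J ⊆ I →
    (∑' lam : J, weightedHSSq μ (fun x => (1 + ‖x‖ ^ 2) ^ (-κ)) (eigenProj H lam)) < ⊤

end Position

end

end DynLoc

open MeasureTheory
open scoped ENNReal

namespace DynLoc

/-! ### Resolvent, functional calculus and eigenprojections of a self-adjoint operator. -/

section OperatorTheory

open scoped InnerProductSpace

variable {E : Type*} [NormedAddCommGroup E] [InnerProductSpace ℂ E] {H : E →ₗ.[ℂ] E}

/-! Pure point spectrum in `I` gives the strongly convergent expansion e^{-itH} X(H) = ∑ e^{-itl}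
X(l) P_l over eigenvalues l (`hasSum_evol_apply`). Everything is then a question about the pieces
χ_x P_l χ_u, and the five properties are linked in the cycle SULP → SUDL → uniform → Abel → averaged
→ SULP.

The hard step is SULP → SUDL. The triangle inequality removes the phases and leaves ∑_l X(l) ‖χ_x
P_l χ_u‖₂, while SULP only bounds each term. Put s_l(y) = ‖P_l χ_y‖₂ and a_l(y) = ‖χ_y P_l χ_u‖₂.
The sums ∑_l s_l(y)² over a compact set of energies grow slower than any prescribed stretched
exponential in y (`exists_tsum_hsNorm_eigenProj_le`): by the trace condition for Lebesgue measure,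
and by Bessel's inequality on the lattice, where χ_y has rank one. Spending half of the SULP bound
on the decay leaves about s_l(u)^{1/2} to be summed, a power too low for square summability. But
s_l(u)² = ∑_y a_l(y)² and a_l(y) ≤ s_l(y) s_l(u), so localization itself trades s_l(u)^{1/2} for
squares weighted by small powers of a_l(y), which SULP makes summable in y (`rpow_half_le_tsum`,
`tsum_mul_le_of_localized`).

SUDL gives uniform moments by summing over boxes, and the next two steps compare time averages. To
return to SULP, restrict the moment to one box and average in time: after multiplication by e^{i lam
t} every other eigenvalue oscillates away and X(lam) χ_x P_lam χ_u survives
(`exists_continuous_le_norm_sq_of_hasSum`, `hsNorm_eigenProj_sq_le_of_average`). Continuous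
minorants are used there, so measurability of the moments in time is never needed. -/

theorem IsResolventAt.sub_eq_smul_mul {z w : ℂ} {R S : E →L[ℂ] E} (hR : IsResolventAt H z R)
    (hS : IsResolventAt H w S) : R - S = (z - w) • (R * S) := by
  ext y
  obtain ⟨hd, hy⟩ := hS.1 y
  have h := hR.2 ⟨S y, hd⟩
  have h2 : R y = R (H ⟨S y, hd⟩) - w • R (S y) := by
    rw [← map_smul, ← map_sub, hy]
  rw [map_sub, map_smul] at h
  simp only [sub_apply, smul_apply,
    mul_apply_eq_comp]
  rw [h2, sub_smul, sub_sub, add_comm, ← sub_sub, sub_left_inj, sub_eq_iff_eq_add,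
    sub_eq_iff_eq_add.mp h, add_comm]

theorem mem_eigenspace_iff {lam : ℝ} {x : E} :
    x ∈ eigenspace H lam ↔ ∃ h : x ∈ H.domain, H ⟨x, h⟩ = (lam : ℂ) • x := by
  simp only [eigenspace, Submodule.mem_map, LinearMap.mem_ker, LinearMap.sub_apply,
    LinearMap.smul_apply, Submodule.subtype_apply, sub_eq_zero]
  constructor
  · rintro ⟨y, hy, rfl⟩
    exact ⟨y.2, hy⟩
  · rintro ⟨h, hx⟩
    exact ⟨⟨x, h⟩, hx, rfl⟩

theorem IsResolventAt.apply_eigenvector {z : ℂ} {R : E →L[ℂ] E} (hR : IsResolventAt H z R)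
    {lam : ℝ} (hz : (lam : ℂ) ≠ z) {x : E} (hx : x ∈ eigenspace H lam) :
    R x = ((lam : ℂ) - z)⁻¹ • x := by
  obtain ⟨h, hx⟩ := mem_eigenspace_iff.mp hx
  have h1 := hR.2 ⟨x, h⟩
  rw [hx, ← sub_smul, map_smul] at h1
  simp only at h1
  nth_rewrite 2 [← h1]
  rw [inv_smul_smul₀ (sub_ne_zero.mpr hz)]

theorem IsResolventAt.mem_eigenspace {z : ℂ} {R : E →L[ℂ] E} (hR : IsResolventAt H z R)
    {lam : ℝ} (hz : (lam : ℂ) ≠ z) {x : E} (hx : R x = ((lam : ℂ) - z)⁻¹ • x) :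
    x ∈ eigenspace H lam := by
  have h0 := sub_ne_zero.mpr hz
  have hx' : x = ((lam : ℂ) - z) • R x := by rw [hx, smul_inv_smul₀ h0]
  obtain ⟨hd, he⟩ := hR.1 x
  have hm : x ∈ H.domain := by
    rw [hx']
    exact H.domain.smul_mem _ hd
  refine mem_eigenspace_iff.mpr ⟨hm, ?_⟩
  have h3 : (⟨x, hm⟩ : H.domain) = ((lam : ℂ) - z) • ⟨R x, hd⟩ := Subtype.ext hx'
  rw [h3, H.map_smul, sub_eq_iff_eq_add.mp he]
  nth_rewrite 1 [hx']
  rw [← add_smul, ← smul_assoc]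
  nth_rewrite 2 [hx']
  rw [smul_smul, smul_eq_mul]
  congr 1
  ring

variable [CompleteSpace E]

theorem inner_apply_comm (hH : IsSelfAdjoint H) (x y : H.domain) :
    ⟪H x, (y : E)⟫_ℂ = ⟪(x : E), H y⟫_ℂ := by
  have h := LinearPMap.adjoint_isFormalAdjoint hH.dense_domain
  rw [LinearPMap.isSelfAdjoint_def.mp hH] at h
  exact h x y

theorem mem_domain_of_inner (hH : IsSelfAdjoint H) {y w : E}
    (h : ∀ x : H.domain, ⟪w, (x : E)⟫_ℂ = ⟪y, H x⟫_ℂ) : ∃ hy : y ∈ H.domain, H ⟨y, hy⟩ = w := by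
  have h0 : ∃ hy : y ∈ H.adjoint.domain, H.adjoint ⟨y, hy⟩ = w :=
    ⟨LinearPMap.mem_adjoint_domain_of_exists _ ⟨w, h⟩,
      LinearPMap.adjoint_apply_eq hH.dense_domain _ h⟩
  rwa [LinearPMap.isSelfAdjoint_def.mp hH] at h0

theorem norm_sq_sub_smul (hH : IsSelfAdjoint H) {z : ℂ} (hz : z = Complex.I ∨ z = -Complex.I)
    (x : H.domain) : ‖H x - z • (x : E)‖ ^ 2 = ‖H x‖ ^ 2 + ‖(x : E)‖ ^ 2 := by
  have hr : RCLike.re ⟪H x, z • (x : E)⟫_ℂ = 0 := by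
    have h1 := inner_apply_comm hH x x
    have h2 : (⟪H x, (x : E)⟫_ℂ).im = 0 := by
      have := inner_conj_symm (𝕜 := ℂ) (x : E) (H x)
      rw [← h1] at this
      exact Complex.conj_eq_iff_im.mp this
    rw [inner_smul_right]
    rcases hz with rfl | rfl <;> simp [h2]
  have hn : ‖z‖ = 1 := by rcases hz with rfl | rfl <;> simp
  rw [@norm_sub_sq ℂ, hr, norm_smul, hn]
  ring

/-- By `norm_sq_sub_smul`, H ∓ i is bounded below in the graph norm, so its range is closed because
the graph is. A vector orthogonal to the range lies in the domain of H* = H as an eigenvector with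
eigenvalue conj z, and the same identity forces it to vanish. -/
theorem exists_isResolventAt (hH : IsSelfAdjoint H) {z : ℂ}
    (hz : z = Complex.I ∨ z = -Complex.I) : ∃ R : E →L[ℂ] E, IsResolventAt H z R := by
  have hn : ‖z‖ = 1 := by rcases hz with rfl | rfl <;> simp
  let L : H.domain →ₗ[ℂ] E := H.toFun - z • H.domain.subtype
  have hL : ∀ x, L x = H x - z • (x : E) := fun x => rfl
  have hb1 : ∀ x : H.domain, ‖(x : E)‖ ≤ ‖L x‖ := fun x => by
    have := norm_sq_sub_smul hH hz x
    rw [hL]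
    nlinarith [norm_nonneg (H x - z • (x : E)), norm_nonneg (x : E), sq_nonneg ‖H x‖]
  have hb2 : ∀ x : H.domain, ‖H x‖ ≤ ‖L x‖ := fun x => by
    have := norm_sq_sub_smul hH hz x
    rw [hL]
    nlinarith [norm_nonneg (H x - z • (x : E)), norm_nonneg (H x), sq_nonneg ‖(x : E)‖]
  have hclosed : IsClosed (LinearMap.range L : Set E) := by
    have hg : IsClosed (H.graph : Set (E × E)) := hH.isClosed
    have : CompleteSpace H.graph := hg.completeSpace_coe
    let G : H.graph →L[ℂ] E :=
      ((ContinuousLinearMap.snd ℂ E E) - z • (ContinuousLinearMap.fst ℂ E E)).comp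
        H.graph.subtypeL
    have hG : ∀ p : H.graph, ∃ x : H.domain, (p : E × E) = ((x : E), H x) := fun p => by
      obtain ⟨y, h1, h2⟩ := (LinearPMap.mem_graph_iff H).mp p.2
      exact ⟨y, Prod.ext h1.symm h2.symm⟩
    have hanti : AntilipschitzWith 1 G := by
      refine AddMonoidHomClass.antilipschitz_of_bound G fun p => ?_
      obtain ⟨x, hx⟩ := hG p
      have : G p = L x := by simp [G, hx, hL]
      rw [this, NNReal.coe_one, one_mul, ← Submodule.norm_coe, hx]
      exact max_le (hb1 x) (hb2 x)
    have hr : (LinearMap.range L : Set E) = Set.range G := by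
      ext y
      constructor
      · rintro ⟨x, rfl⟩
        exact ⟨⟨(x, H x), H.mem_graph x⟩, by simp [G, hL]⟩
      · rintro ⟨p, rfl⟩
        obtain ⟨x, hx⟩ := hG p
        exact ⟨x, by simp [G, hx, hL]⟩
    rw [hr]
    exact hanti.isClosed_range G.uniformContinuous
  have htop : LinearMap.range L = ⊤ := by
    have : CompleteSpace (LinearMap.range L) := hclosed.completeSpace_coe
    rw [← Submodule.orthogonal_eq_bot_iff, Submodule.eq_bot_iff]
    intro y hy
    have h0 : ∀ x : H.domain, ⟪L x, y⟫_ℂ = 0 := fun x => hy _ ⟨x, rfl⟩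
    obtain ⟨hyd, hye⟩ := mem_domain_of_inner hH (y := y) (w := (starRingEnd ℂ z) • y) fun x => by
      have := congrArg (starRingEnd ℂ) (h0 x)
      rw [inner_conj_symm, hL, inner_sub_right, inner_smul_right, map_zero, sub_eq_zero] at this
      rw [inner_smul_left, Complex.conj_conj, this]
    have := norm_sq_sub_smul hH (z := starRingEnd ℂ z)
      (by rcases hz with rfl | rfl <;> simp) ⟨y, hyd⟩
    rw [hye] at this
    simp only [sub_self, norm_zero] at this
    have h3 : ‖y‖ ^ 2 ≤ 0 := by nlinarith [sq_nonneg ‖(starRingEnd ℂ z) • y‖]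
    exact norm_eq_zero.mp (by nlinarith [norm_nonneg y])
  have hinj : Function.Injective L := by
    rw [← LinearMap.ker_eq_bot, LinearMap.ker_eq_bot']
    intro x hx
    have := hb1 x
    rw [hx, norm_zero] at this
    exact Subtype.ext (norm_le_zero_iff.mp this)
  let e : H.domain ≃ₗ[ℂ] E := LinearEquiv.ofBijective L ⟨hinj, LinearMap.range_eq_top.mp htop⟩
  have he : ∀ x, e x = H x - z • (x : E) := fun x => rfl
  let R : E →L[ℂ] E := (H.domain.subtype ∘ₗ e.symm.toLinearMap).mkContinuous 1 fun y => by
    have := hb1 (e.symm y)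
    rw [one_mul]
    refine this.trans_eq ?_
    rw [hL, ← he, e.apply_symm_apply]
  have hR : ∀ y, R y = e.symm y := fun y => rfl
  refine ⟨R, fun y => ⟨(e.symm y).2, ?_⟩, fun x => ?_⟩
  · have := e.apply_symm_apply y
    rw [he] at this
    exact this
  · rw [hR, ← he, e.symm_apply_apply]

theorem isResolventAt_resolventAt (hH : IsSelfAdjoint H) {z : ℂ}
    (hz : z = Complex.I ∨ z = -Complex.I) : IsResolventAt H z (resolventAt H z) := by
  have h := exists_isResolventAt hH hz
  rw [resolventAt, dif_pos h]
  exact Classical.choose_spec h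

theorem star_resolventAt (hH : IsSelfAdjoint H) :
    star (resolventAt H (-Complex.I)) = resolventAt H Complex.I := by
  have hR := isResolventAt_resolventAt hH (z := -Complex.I) (.inr rfl)
  have hS := isResolventAt_resolventAt hH (z := Complex.I) (.inl rfl)
  rw [ContinuousLinearMap.star_eq_adjoint, eq_comm, ContinuousLinearMap.eq_adjoint_iff]
  intro x y
  obtain ⟨hx, hx'⟩ := hS.1 x
  obtain ⟨hy, hy'⟩ := hR.1 y
  have h := inner_apply_comm hH ⟨_, hx⟩ ⟨_, hy⟩
  change ⟪_, resolventAt H (-Complex.I) y⟫_ℂ = ⟪resolventAt H Complex.I x, _⟫_ℂ at h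
  calc ⟪resolventAt H Complex.I x, y⟫_ℂ
      = ⟪resolventAt H Complex.I x, H ⟨_, hy⟩ - -Complex.I • resolventAt H (-Complex.I) y⟫_ℂ := by
        rw [hy']
    _ = ⟪H ⟨_, hx⟩ - Complex.I • resolventAt H Complex.I x, resolventAt H (-Complex.I) y⟫_ℂ := by
        rw [inner_sub_left, inner_sub_right, inner_smul_left, inner_smul_right, h]
        simp
    _ = _ := by rw [hx']

theorem resolventAt_mul_star (hH : IsSelfAdjoint H) :
    resolventAt H (-Complex.I) - star (resolventAt H (-Complex.I)) =
      (-2 * Complex.I) • (resolventAt H (-Complex.I) * star (resolventAt H (-Complex.I))) := by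
  rw [star_resolventAt hH, (isResolventAt_resolventAt hH (.inr rfl)).sub_eq_smul_mul
    (isResolventAt_resolventAt hH (.inl rfl))]
  congr 1
  ring

theorem isStarNormal_resolventAt (hH : IsSelfAdjoint H) :
    IsStarNormal (resolventAt H (-Complex.I)) := by
  have hR := isResolventAt_resolventAt hH (z := -Complex.I) (.inr rfl)
  have hS := isResolventAt_resolventAt hH (z := Complex.I) (.inl rfl)
  have h1 := hR.sub_eq_smul_mul hS
  have h2 := hS.sub_eq_smul_mul hR
  constructor
  rw [star_resolventAt hH, Commute, SemiconjBy]
  have h3 : (-Complex.I - Complex.I) • (resolventAt H (-Complex.I) * resolventAt H Complex.I) =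
      (-Complex.I - Complex.I) • (resolventAt H Complex.I * resolventAt H (-Complex.I)) := by
    rw [← h1, ← neg_sub (resolventAt H Complex.I), h2, ← neg_smul]
    congr 1
    ring
  refine (smul_right_injective _ (r := (-Complex.I - Complex.I : ℂ)) ?_ h3).symm
  intro h
  have := congrArg Complex.im h
  norm_num at this

/-- The relation R - R* = -2i R R* passes through the functional calculus to each spectral value: z
- conj z = -2i |z|². This places the nonzero spectrum on the curve z = 1/(lam + i) with lam real. -/
theorem inv_im_eq_one_of_mem_spectrum (hH : IsSelfAdjoint H) {z : ℂ}
    (hz : z ∈ spectrum ℂ (resolventAt H (-Complex.I))) (hz0 : z ≠ 0) : (z⁻¹).im = 1 := by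
  set R := resolventAt H (-Complex.I) with hR
  have hn : IsStarNormal R := isStarNormal_resolventAt hH
  have h0 : cfc (fun w : ℂ => (w - star w) - (-2 * Complex.I) * (w * star w)) R = 0 := by
    rw [cfc_sub (fun w : ℂ => w - star w) (fun w : ℂ => (-2 * Complex.I) * (w * star w)) R,
      cfc_sub (fun w : ℂ => w) (fun w : ℂ => star w) R,
      cfc_const_mul (-2 * Complex.I) (fun w : ℂ => w * star w) R,
      cfc_mul (fun w : ℂ => w) (fun w : ℂ => star w) R, cfc_star (fun w : ℂ => w) R,
      cfc_id' ℂ R, hR, resolventAt_mul_star hH, sub_self]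
  have h1 : (fun w : ℂ => (w - star w) - (-2 * Complex.I) * (w * star w)) z ∈
      spectrum ℂ (0 : E →L[ℂ] E) := by
    rw [← h0, cfc_map_spectrum (fun w : ℂ => (w - star w) - (-2 * Complex.I) * (w * star w)) R]
    exact ⟨z, hz, rfl⟩
  have hnt : Nontrivial (E →L[ℂ] E) := by
    by_contra hc
    rw [not_nontrivial_iff_subsingleton] at hc
    rw [spectrum.of_subsingleton] at h1
    exact h1
  rw [spectrum.zero_eq, Set.mem_singleton_iff] at h1
  have h2 := congrArg Complex.im h1
  simp [Complex.mul_im, Complex.mul_re] at h2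
  have h3 : Complex.normSq z ≠ 0 := fun h => hz0 (Complex.normSq_eq_zero.mp h)
  rw [Complex.inv_im, div_eq_one_iff_eq h3, Complex.normSq_apply]
  linarith

/-- Only the point 0 is delicate: on the spectrum a small w ≠ 0 has Im w⁻¹ = 1, hence large |Re
w⁻¹|, outside the support of f. Without this continuity `cfc` would take its default value 0. -/
theorem continuousOn_funCalc (hH : IsSelfAdjoint H) {f : ℝ → ℂ} (hf : Continuous f)
    (hc : HasCompactSupport f) :
    ContinuousOn (fun z : ℂ => if z = 0 then 0 else f (z⁻¹).re)
      (spectrum ℂ (resolventAt H (-Complex.I))) := by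
  intro z hz
  by_cases hz0 : z = 0
  · subst hz0
    obtain ⟨r, hr⟩ := hc.isCompact.isBounded.subset_closedBall 0
    have hev : ∀ᶠ w in nhdsWithin (0 : ℂ) (spectrum ℂ (resolventAt H (-Complex.I))),
        (fun z : ℂ => if z = 0 then 0 else f (z⁻¹).re) w = 0 := by
      have hs : Metric.ball (0 : ℂ) (1 / (|r| + 2)) ∈ nhds (0 : ℂ) :=
        Metric.ball_mem_nhds _ (by positivity)
      filter_upwards [self_mem_nhdsWithin, mem_nhdsWithin_of_mem_nhds hs] with w hw hwb
      by_cases hw0 : w = 0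
      · simp [hw0]
      · simp only [hw0, if_false]
        by_contra hne
        have h1 : (w⁻¹).re ∈ Metric.closedBall (0 : ℝ) r := hr (subset_tsupport _ hne)
        rw [mem_closedBall_zero_iff, Real.norm_eq_abs] at h1
        have h2 := inv_im_eq_one_of_mem_spectrum hH hw hw0
        have h3 := Complex.norm_le_abs_re_add_abs_im w⁻¹
        rw [h2, abs_one, norm_inv] at h3
        rw [mem_ball_zero_iff] at hwb
        have h4 : |r| + 2 < ‖w‖⁻¹ := by
          rw [lt_inv_comm₀ (by positivity) (norm_pos_iff.mpr hw0)]
          simpa using hwb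
        linarith [le_abs_self r]
    rw [ContinuousWithinAt]
    simp only [if_true]
    exact (Filter.tendsto_congr' hev).mpr tendsto_const_nhds
  · have : ContinuousAt (fun z : ℂ => f (z⁻¹).re) z :=
      hf.continuousAt.comp (Complex.continuous_re.continuousAt.comp (continuousAt_inv₀ hz0))
    refine (this.congr ?_).continuousWithinAt
    filter_upwards [isOpen_ne.mem_nhds hz0] with w hw
    have : w ≠ 0 := hw
    simp [this]

theorem ofReal_ne_neg_I (lam : ℝ) : (lam : ℂ) ≠ -Complex.I := fun h => by
  have := congrArg Complex.im h
  simp at this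

theorem ofReal_ne_I (lam : ℝ) : (lam : ℂ) ≠ Complex.I := fun h => by
  have := congrArg Complex.im h
  simp at this

theorem isClosed_eigenspace (hH : IsSelfAdjoint H) (lam : ℝ) :
    IsClosed (eigenspace H lam : Set E) := by
  have hR := isResolventAt_resolventAt hH (z := -Complex.I) (.inr rfl)
  have : (eigenspace H lam : Set E) =
      {x | resolventAt H (-Complex.I) x = ((lam : ℂ) - -Complex.I)⁻¹ • x} := by
    ext x
    exact ⟨hR.apply_eigenvector (ofReal_ne_neg_I lam), hR.mem_eigenspace (ofReal_ne_neg_I lam)⟩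
  rw [this]
  exact isClosed_eq (by fun_prop) (by fun_prop)

theorem closure_eigenspace (hH : IsSelfAdjoint H) (lam : ℝ) :
    (eigenspace H lam).topologicalClosure = eigenspace H lam :=
  (isClosed_eigenspace hH lam).submodule_topologicalClosure_eq

theorem eigenProj_mem (hH : IsSelfAdjoint H) (lam : ℝ) (x : E) :
    eigenProj H lam x ∈ eigenspace H lam := by
  rw [← closure_eigenspace hH]
  exact Submodule.starProjection_apply_mem _ _

theorem eigenProj_apply_of_mem {lam : ℝ} {x : E} (hx : x ∈ eigenspace H lam) :
    eigenProj H lam x = x :=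
  Submodule.starProjection_eq_self_iff.mpr (Submodule.le_topologicalClosure _ hx)

theorem inner_eigenProj_left (lam : ℝ) (x y : E) :
    ⟪eigenProj H lam x, y⟫_ℂ = ⟪x, eigenProj H lam y⟫_ℂ :=
  Submodule.inner_starProjection_left_eq_right _ _ _

theorem eigenProj_comp_self (lam : ℝ) : eigenProj H lam ∘L eigenProj H lam = eigenProj H lam := by
  ext x
  exact Submodule.starProjection_eq_self_iff.mpr (Submodule.starProjection_apply_mem _ _)

theorem adjoint_eigenProj (lam : ℝ) :
    ContinuousLinearMap.adjoint (eigenProj H lam) = eigenProj H lam := by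
  rw [eq_comm, ContinuousLinearMap.eq_adjoint_iff]
  exact inner_eigenProj_left lam

/-- An eigenvector of H is a joint eigenvector of the resolvent and its adjoint. Stone–Weierstrass
induction carries this to every continuous function on the spectrum. -/
theorem funCalc_apply_eigenvector (hH : IsSelfAdjoint H) {f : ℝ → ℂ} (hf : Continuous f)
    (hc : HasCompactSupport f) {lam : ℝ} {x : E} (hx : x ∈ eigenspace H lam) :
    funCalc H f x = f lam • x := by
  by_cases hx0 : x = 0
  · simp [hx0]
  have hR := isResolventAt_resolventAt hH (z := -Complex.I) (.inr rfl)
  have hS := isResolventAt_resolventAt hH (z := Complex.I) (.inl rfl)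
  have hRx := hR.apply_eigenvector (ofReal_ne_neg_I lam) hx
  have hSx := hS.apply_eigenvector (ofReal_ne_I lam) hx
  rw [← star_resolventAt hH] at hSx
  have hn := isStarNormal_resolventAt hH
  have hcont := continuousOn_funCalc hH hf hc
  rw [funCalc]
  set R := resolventAt H (-Complex.I)
  set z : ℂ := ((lam : ℂ) - -Complex.I)⁻¹ with hz
  have hz0 : z ≠ 0 := inv_ne_zero (sub_ne_zero.mpr (ofReal_ne_neg_I lam))
  have hmem : z ∈ spectrum ℂ R := by
    rw [spectrum.mem_iff]
    intro hu
    obtain ⟨v, hv⟩ := hu.exists_left_inv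
    have h1 : (v * (algebraMap ℂ (E →L[ℂ] E) z - R)) x = x := by rw [hv]; rfl
    rw [mul_apply_eq_comp, sub_apply, hRx,
      ContinuousLinearMap.algebraMap_apply, sub_self, map_zero] at h1
    exact hx0 h1.symm
  have key : ∀ g : C(spectrum ℂ R, ℂ), cfcHom (a := R) hn g x = g ⟨z, hmem⟩ • x := by
    intro g
    induction g using ContinuousMap.induction_on_of_compact with
    | const r =>
      have : ContinuousMap.const (spectrum ℂ R) r = algebraMap ℂ C(spectrum ℂ R, ℂ) r := rfl
      rw [this, AlgHomClass.commutes]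
      simp
    | id => rw [cfcHom_id]; exact hRx
    | star_id =>
      rw [map_star, cfcHom_id, hSx]
      congr 1
      simp [z, sub_eq_add_neg]
    | add f g hf hg => rw [map_add, add_apply, hf, hg, ← add_smul]; rfl
    | mul f g hf hg =>
      rw [map_mul, mul_apply_eq_comp, hg, map_smul, hf, smul_smul, mul_comm]; rfl
    | frequently f h =>
      refine h.mem_of_closed (isClosed_eq ?_ ?_)
      · exact ((ContinuousLinearMap.apply ℂ E x).continuous).comp (cfcHom_continuous hn)
      · exact (continuous_eval_const _).smul continuous_const
  rw [cfc_apply _ R hn hcont, key]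
  simp only [ContinuousMap.coe_mk, Set.domRestrict_apply, hz0, if_false]
  congr 2
  simp [z]

theorem adjoint_funCalc (f : ℝ → ℂ) :
    ContinuousLinearMap.adjoint (funCalc H f) = funCalc H fun lam => star (f lam) := by
  rw [← ContinuousLinearMap.star_eq_adjoint, funCalc, ← cfc_star, funCalc]
  congr 1
  ext z
  split_ifs <;> simp

/-- Taking adjoints moves f(H) onto the range of P_lam, where it acts as a scalar. -/
theorem eigenProj_funCalc_apply (hH : IsSelfAdjoint H) {f : ℝ → ℂ} (hf : Continuous f)
    (hc : HasCompactSupport f) (lam : ℝ) (x : E) :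
    eigenProj H lam (funCalc H f x) = f lam • eigenProj H lam x := by
  refine ext_inner_left ℂ fun y => ?_
  rw [← inner_eigenProj_left, inner_smul_right, ← inner_eigenProj_left,
    ← ContinuousLinearMap.adjoint_inner_left, adjoint_funCalc,
    funCalc_apply_eigenvector hH (f := fun lam => star (f lam)) hf.star
      (hc.comp_left (g := star) (star_zero ℂ)) (eigenProj_mem hH _ _), inner_smul_left]
  simp

theorem inner_eq_zero_of_mem_eigenspace (hH : IsSelfAdjoint H) {l m : ℝ} (hlm : l ≠ m) {x y : E}
    (hx : x ∈ eigenspace H l) (hy : y ∈ eigenspace H m) : ⟪x, y⟫_ℂ = 0 := by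
  obtain ⟨hxd, hx⟩ := mem_eigenspace_iff.mp hx
  obtain ⟨hyd, hy⟩ := mem_eigenspace_iff.mp hy
  have h := inner_apply_comm hH ⟨x, hxd⟩ ⟨y, hyd⟩
  rw [hx, hy, inner_smul_left, inner_smul_right, Complex.conj_ofReal] at h
  have h2 : ((l : ℂ) - m) * ⟪x, y⟫_ℂ = 0 := by rw [sub_mul, h, sub_self]
  refine (mul_eq_zero.mp h2).resolve_left (sub_ne_zero.mpr ?_)
  exact_mod_cast hlm

theorem orthogonalFamily_eigenspace (hH : IsSelfAdjoint H) :
    OrthogonalFamily ℂ (fun l => eigenspace H l) fun l => (eigenspace H l).subtypeₗᵢ :=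
  fun _ _ hlm x y => inner_eq_zero_of_mem_eigenspace hH hlm x.2 y.2

/-- The eigenspaces are closed and mutually orthogonal, so the pure point subspace is their Hilbert
sum; applying P_l to the expansion identifies its components. -/
theorem hasSum_eigenProj (hH : IsSelfAdjoint H) {x : E} (hx : x ∈ purePointSubspace H) :
    HasSum (fun l => eigenProj H l x) x := by
  have hV := orthogonalFamily_eigenspace hH
  have : ∀ l, CompleteSpace (eigenspace H l) := fun l =>
    (isClosed_eigenspace hH l).completeSpace_coe
  have hx' : x ∈ LinearMap.range hV.linearIsometry.toLinearMap := by
    rw [hV.range_linearIsometry]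
    convert hx using 1
    simp [purePointSubspace]
  obtain ⟨g, rfl⟩ := hx'
  have hs := hV.hasSum_linearIsometry g
  change HasSum _ (hV.linearIsometry g)
  convert hs using 1
  ext l
  have h2 := hs.mapL (eigenProj H l)
  refine (h2.unique ?_)
  convert hasSum_single l (f := fun m => eigenProj H l ((eigenspace H m).subtypeₗᵢ (g m))) ?_ using 1
  · exact (eigenProj_apply_of_mem (g l).2).symm
  · intro m hm
    refine ext_inner_left ℂ fun y => ?_
    rw [← inner_eigenProj_left, inner_zero_right]
    exact inner_eq_zero_of_mem_eigenspace hH hm.symm (eigenProj_mem hH _ _) (g m).2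

theorem hasSum_funCalc_apply (hH : IsSelfAdjoint H) {I : Set ℝ} (hpp : HasPurePointSpectrumIn H I)
    {f : ℝ → ℂ} (hf : Continuous f) (hc : HasCompactSupport f) (hfI : tsupport f ⊆ I) (x : E) :
    HasSum (fun l => f l • eigenProj H l x) (funCalc H f x) := by
  have hm : funCalc H f x ∈ purePointSubspace H := by
    refine hpp (Submodule.le_topologicalClosure _ ?_)
    exact Submodule.mem_iSup_of_mem f
      (Submodule.mem_iSup_of_mem (show f ∈ {f : ℝ → ℂ | _} from ⟨hf, hc, hfI⟩) ⟨x, rfl⟩)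
  have := hasSum_eigenProj hH hm
  simpa only [eigenProj_funCalc_apply hH hf hc] using this

/-- Bessel's inequality for the eigenprojections. -/
theorem tsum_enorm_eigenProj_sq_le (hH : IsSelfAdjoint H) (x : E) :
    ∑' l, ‖eigenProj H l x‖ₑ ^ 2 ≤ ‖x‖ₑ ^ 2 := by
  rw [ENNReal.tsum_eq_iSup_sum]
  refine iSup_le fun s => ?_
  have h : ∑ l ∈ s, ‖eigenProj H l x‖ ^ 2 ≤ ‖x‖ ^ 2 := by
    have h1 : ‖∑ l ∈ s, eigenProj H l x‖ ^ 2 = ∑ l ∈ s, ‖eigenProj H l x‖ ^ 2 :=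
      (orthogonalFamily_eigenspace hH).norm_sum
        (fun l => (⟨eigenProj H l x, eigenProj_mem hH l x⟩ : eigenspace H l)) s
    have h2 : ⟪x, ∑ l ∈ s, eigenProj H l x⟫_ℂ = ((∑ l ∈ s, ‖eigenProj H l x‖ ^ 2 : ℝ) : ℂ) := by
      rw [inner_sum, Complex.ofReal_sum]
      refine Finset.sum_congr rfl fun l _ => ?_
      rw [← eigenProj_apply_of_mem (eigenProj_mem hH l x), ← inner_eigenProj_left,
        eigenProj_apply_of_mem (eigenProj_mem hH l x), inner_self_eq_norm_sq_to_K]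
      simp
    have h3 := norm_inner_le_norm (𝕜 := ℂ) x (∑ l ∈ s, eigenProj H l x)
    rw [h2, Complex.norm_real, Real.norm_of_nonneg (Finset.sum_nonneg fun _ _ => sq_nonneg _),
      ← h1] at h3
    rw [← h1]
    nlinarith [norm_nonneg x, norm_nonneg (∑ l ∈ s, eigenProj H l x)]
  simp only [← ofReal_norm, ← ENNReal.ofReal_pow (norm_nonneg _)]
  rw [← ENNReal.ofReal_sum_of_nonneg fun _ _ => sq_nonneg _]
  exact ENNReal.ofReal_le_ofReal h

end OperatorTheory

/-! ### Hilbert–Schmidt norms. -/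

section HilbertSchmidt

open scoped InnerProductSpace

variable {E : Type*} [NormedAddCommGroup E] [InnerProductSpace ℂ E]

/-- Parseval's identity. -/
theorem tsum_enorm_inner_sq {ι : Type*} (b : HilbertBasis ι ℂ E) (x : E) :
    ∑' i, ‖⟪b i, x⟫_ℂ‖ₑ ^ 2 = ‖x‖ₑ ^ 2 := by
  have h : HasSum (fun i => ‖b.repr x i‖ ^ 2) (‖b.repr x‖ ^ 2) := by
    have := lp.hasSum_norm (p := 2) (by norm_num) (b.repr x)
    simpa using this
  rw [LinearIsometryEquiv.norm_map] at h
  simp only [b.repr_apply_apply] at h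
  have h2 := ENNReal.ofReal_tsum_of_nonneg (fun i => sq_nonneg ‖⟪b i, x⟫_ℂ‖) h.summable
  rw [h.tsum_eq] at h2
  simp only [ENNReal.ofReal_pow (norm_nonneg _), ofReal_norm] at h2
  exact h2.symm

variable [CompleteSpace E]

theorem hsNorm_sq (A : E →L[ℂ] E) : hsNorm A ^ 2 = ∑' i, ‖A (basis E i)‖ₑ ^ 2 := by
  rw [hsNorm, ← ENNReal.rpow_natCast, ← ENNReal.rpow_mul]
  norm_num

theorem hsNorm_le_iff {A : E →L[ℂ] E} {c : ℝ≥0∞} :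
    hsNorm A ≤ c ↔ ∑' i, ‖A (basis E i)‖ₑ ^ 2 ≤ c ^ 2 := by
  rw [← hsNorm_sq, ENNReal.pow_le_pow_left_iff two_ne_zero]

theorem hsNorm_adjoint (A : E →L[ℂ] E) : hsNorm (ContinuousLinearMap.adjoint A) = hsNorm A := by
  have h : hsNorm (ContinuousLinearMap.adjoint A) ^ 2 = hsNorm A ^ 2 := by
    rw [hsNorm_sq, hsNorm_sq]
    simp_rw [← tsum_enorm_inner_sq (basis E)]
    rw [ENNReal.tsum_comm]
    refine tsum_congr fun i => tsum_congr fun j => ?_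
    rw [ContinuousLinearMap.adjoint_inner_right, ← ofReal_norm, ← ofReal_norm, norm_inner_symm]
  exact (ENNReal.pow_right_strictMono two_ne_zero).injective h

/-- Parseval turns ‖A x‖² into coefficients ⟨A* b_i, x⟩, so Cauchy–Schwarz and invariance under
adjoints suffice. -/
theorem enorm_apply_le_hsNorm_mul (A : E →L[ℂ] E) (x : E) : ‖A x‖ₑ ≤ hsNorm A * ‖x‖ₑ := by
  rw [← ENNReal.pow_le_pow_left_iff two_ne_zero, mul_pow, ← hsNorm_adjoint, hsNorm_sq,
    ← ENNReal.tsum_mul_right, ← tsum_enorm_inner_sq (basis E)]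
  refine ENNReal.tsum_le_tsum fun i => ?_
  rw [← ContinuousLinearMap.adjoint_inner_left, ← mul_pow]
  gcongr
  simp only [← ofReal_norm, ← ENNReal.ofReal_mul (norm_nonneg _)]
  exact ENNReal.ofReal_le_ofReal (norm_inner_le_norm _ _)

theorem hsNorm_comp_le_mul (A B : E →L[ℂ] E) : hsNorm (A ∘L B) ≤ hsNorm A * hsNorm B := by
  rw [hsNorm_le_iff, mul_pow, hsNorm_sq B, ← ENNReal.tsum_mul_left]
  refine ENNReal.tsum_le_tsum fun i => ?_
  rw [← mul_pow]
  gcongr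
  exact enorm_apply_le_hsNorm_mul A _

theorem sum_Lp_two_le_sum {ι κ : Type*} (s : Finset ι) (t : Finset κ) (f : κ → ι → ℝ≥0∞) :
    (∑ i ∈ s, (∑ l ∈ t, f l i) ^ (2 : ℝ)) ^ (1 / 2 : ℝ) ≤
      ∑ l ∈ t, (∑ i ∈ s, f l i ^ (2 : ℝ)) ^ (1 / 2 : ℝ) := by
  classical
  induction t using Finset.induction_on with
  | empty => simp
  | insert a t ha ih =>
    simp only [Finset.sum_insert ha]
    exact (ENNReal.Lp_add_le s _ _ one_le_two).trans (add_le_add_right ih _)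

theorem sum_Lp_two_le_tsum {ι κ : Type*} (s : Finset ι) (f : κ → ι → ℝ≥0∞) :
    (∑ i ∈ s, (∑' l, f l i) ^ (2 : ℝ)) ^ (1 / 2 : ℝ) ≤
      ∑' l, (∑ i ∈ s, f l i ^ (2 : ℝ)) ^ (1 / 2 : ℝ) := by
  have h : Filter.Tendsto (fun t : Finset κ =>
      (∑ i ∈ s, (∑ l ∈ t, f l i) ^ (2 : ℝ)) ^ (1 / 2 : ℝ)) Filter.atTop
      (nhds ((∑ i ∈ s, (∑' l, f l i) ^ (2 : ℝ)) ^ (1 / 2 : ℝ))) :=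
    (tendsto_finsetSum _ fun i _ => (ENNReal.summable.hasSum).ennrpow_const _).ennrpow_const _
  exact le_of_tendsto' h fun t => (sum_Lp_two_le_sum s t f).trans (ENNReal.sum_le_tsum t)

/-- Minkowski's inequality in ℓ² over finitely many basis vectors; strong convergence of the series
is enough. -/
theorem hsNorm_le_tsum {κ : Type*} {A : E →L[ℂ] E} {B : κ → E →L[ℂ] E}
    (h : ∀ x, HasSum (fun l => B l x) (A x)) : hsNorm A ≤ ∑' l, hsNorm (B l) := by
  rw [hsNorm_le_iff, ENNReal.tsum_eq_iSup_sum]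
  refine iSup_le fun s => ?_
  have h1 : ∑ i ∈ s, ‖A (basis E i)‖ₑ ^ 2 ≤
      ((∑ i ∈ s, (∑' l, ‖B l (basis E i)‖ₑ) ^ (2 : ℝ)) ^ (1 / 2 : ℝ)) ^ 2 := by
    rw [← ENNReal.rpow_natCast, ← ENNReal.rpow_mul]
    norm_num
    gcongr with i
    rw [← (h (basis E i)).tsum_eq]
    exact enorm_tsum_le_tsum_enorm
  refine h1.trans ?_
  gcongr
  refine (sum_Lp_two_le_tsum s _).trans (ENNReal.tsum_le_tsum fun l => ?_)
  rw [hsNorm]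
  gcongr
  simp only [ENNReal.rpow_two]
  exact ENNReal.sum_le_tsum s

theorem hsNorm_smul (c : ℂ) (A : E →L[ℂ] E) : hsNorm (c • A) = ‖c‖ₑ * hsNorm A := by
  have h : hsNorm (c • A) ^ 2 = (‖c‖ₑ * hsNorm A) ^ 2 := by
    rw [mul_pow, hsNorm_sq, hsNorm_sq, ← ENNReal.tsum_mul_left]
    refine tsum_congr fun i => ?_
    rw [smul_apply, enorm_smul, mul_pow]
  exact (ENNReal.pow_right_strictMono two_ne_zero).injective h

end HilbertSchmidt

/-! ### Summing localized terms over eigenvalues. -/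

/-- If `s` and `a` behave like `s u = ‖P χ_u‖₂` and `a y = ‖χ_y P χ_u‖₂` for a projection `P` and
a partition of unity `χ`, then low powers of `s u` are controlled by `a` and the squares of `s`. -/
theorem rpow_half_le_tsum {Y : Type*} {s a : Y → ℝ≥0∞} {u : Y} (hu : s u ≠ ⊤)
    (hs : s u ^ 2 = ∑' y, a y ^ 2) (ha : ∀ y, a y ≤ s y * s u) :
    s u ^ (1 / 2 : ℝ) ≤ ∑' y, a y ^ (1 / 4 : ℝ) * (s y ^ 2 + s u ^ 2) := by
  by_cases h0 : s u = 0
  · simp [h0]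
  have hsplit : s u ^ (1 / 2 : ℝ) = s u ^ 2 * s u ^ (-(3 / 2) : ℝ) := by
    rw [← ENNReal.rpow_two, ← ENNReal.rpow_add _ _ h0 hu]
    norm_num
  rw [hsplit]
  refine (congrArg (· * s u ^ (-(3 / 2) : ℝ)) hs).trans_le ?_
  rw [← ENNReal.tsum_mul_right]
  refine ENNReal.tsum_le_tsum fun y => ?_
  -- Keep a^{1/4} for summability in y and spend a^{7/4} on a ≤ s_y s_u. After division by s_u^{3/2}
  -- the remaining s_y^{7/4} s_u^{1/4} has total degree 2, hence is bounded by squares.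
  have h1 : a y ^ 2 ≤ a y ^ (1 / 4 : ℝ) * (s y ^ (7 / 4 : ℝ) * s u ^ (7 / 4 : ℝ)) := by
    have : a y ^ 2 = a y ^ (1 / 4 : ℝ) * a y ^ (7 / 4 : ℝ) := by
      rw [← ENNReal.rpow_two, ← ENNReal.rpow_add_of_nonneg _ _ (by norm_num) (by norm_num)]
      norm_num
    rw [this, ← ENNReal.mul_rpow_of_nonneg _ _ (by norm_num)]
    gcongr
    exact ha y
  have h2 : s u ^ (7 / 4 : ℝ) * s u ^ (-(3 / 2) : ℝ) = s u ^ (1 / 4 : ℝ) := by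
    rw [← ENNReal.rpow_add _ _ h0 hu]
    norm_num
  have h3 : s y ^ (7 / 4 : ℝ) * s u ^ (1 / 4 : ℝ) ≤ s y ^ 2 + s u ^ 2 := by
    calc s y ^ (7 / 4 : ℝ) * s u ^ (1 / 4 : ℝ)
        ≤ max (s y) (s u) ^ (7 / 4 : ℝ) * max (s y) (s u) ^ (1 / 4 : ℝ) := by
          gcongr
          · exact le_max_left _ _
          · exact le_max_right _ _
      _ = max (s y) (s u) ^ 2 := by
          rw [← ENNReal.rpow_add_of_nonneg _ _ (by norm_num) (by norm_num), ← ENNReal.rpow_two]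
          norm_num
      _ ≤ s y ^ 2 + s u ^ 2 := by
          rcases max_cases (s y) (s u) with ⟨h, _⟩ | ⟨h, _⟩ <;> rw [h]
          · exact le_self_add
          · exact le_add_self
  calc a y ^ 2 * s u ^ (-(3 / 2) : ℝ)
      ≤ a y ^ (1 / 4 : ℝ) * (s y ^ (7 / 4 : ℝ) * s u ^ (7 / 4 : ℝ)) * s u ^ (-(3 / 2) : ℝ) := by
        gcongr
    _ = a y ^ (1 / 4 : ℝ) * (s y ^ (7 / 4 : ℝ) * (s u ^ (7 / 4 : ℝ) * s u ^ (-(3 / 2) : ℝ))) := by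
        ring
    _ ≤ _ := by
        rw [h2]
        gcongr

/-- Write w a = (w a)^{1/2} (w a)^{1/2}. The first factor takes the pointwise bound and its decay in
x. In the second, a ≤ s_u and `rpow_half_le_tsum` apply, with w^{1/2} shared between M^{1/4} and the
factor that completes a_y^{1/4} to (w a_y)^{1/4}. Only squares of s are then summed over i. -/
theorem tsum_mul_le_of_localized {ι Y : Type*} {w : ι → ℝ≥0∞} {s : ι → Y → ℝ≥0∞}
    {a : ι → Y → ℝ≥0∞} {e : Y → ℝ≥0∞} {u : Y} {A M : ℝ≥0∞} (hu : ∀ i, s i u ≠ ⊤)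
    (hs : ∀ i, s i u ^ 2 = ∑' y, a i y ^ 2) (ha : ∀ i y, a i y ≤ s i y * s i u)
    (hw : ∀ i, w i ≤ M) (he : ∀ i y, w i * a i y ≤ A * e y) (x : Y) :
    ∑' i, w i * a i x ≤ (A * e x) ^ (1 / 2 : ℝ) * (M ^ (1 / 4 : ℝ) *
      ∑' y, (A * e y) ^ (1 / 4 : ℝ) * (∑' i, s i y ^ 2 + ∑' i, s i u ^ 2)) := by
  have h1 : ∀ i, w i * a i x ≤ (A * e x) ^ (1 / 2 : ℝ) * (M ^ (1 / 4 : ℝ) *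
      ∑' y, (A * e y) ^ (1 / 4 : ℝ) * (s i y ^ 2 + s i u ^ 2)) := by
    intro i
    have hau : a i x ≤ s i u := by
      rw [← ENNReal.pow_le_pow_left_iff two_ne_zero, hs]
      exact ENNReal.le_tsum x
    have hsq : ∀ c : ℝ≥0∞, c = c ^ (1 / 2 : ℝ) * c ^ (1 / 2 : ℝ) := fun c => by
      rw [← ENNReal.rpow_add_of_nonneg _ _ (by norm_num) (by norm_num)]
      norm_num
    have hq : w i ^ (1 / 2 : ℝ) = w i ^ (1 / 4 : ℝ) * w i ^ (1 / 4 : ℝ) := by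
      rw [← ENNReal.rpow_add_of_nonneg _ _ (by norm_num) (by norm_num)]
      norm_num
    rw [hsq (w i * a i x)]
    refine mul_le_mul' (ENNReal.rpow_le_rpow (he i x) (by norm_num)) ?_
    · rw [ENNReal.mul_rpow_of_nonneg _ _ (by norm_num), hq, mul_assoc]
      refine mul_le_mul' (ENNReal.rpow_le_rpow (hw i) (by norm_num)) ?_
      · calc w i ^ (1 / 4 : ℝ) * a i x ^ (1 / 2 : ℝ) ≤ w i ^ (1 / 4 : ℝ) * s i u ^ (1 / 2 : ℝ) := by
              gcongr
          _ ≤ w i ^ (1 / 4 : ℝ) * ∑' y, a i y ^ (1 / 4 : ℝ) * (s i y ^ 2 + s i u ^ 2) := by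
              gcongr
              exact rpow_half_le_tsum (hu i) (hs i) (ha i)
          _ ≤ _ := by
              rw [← ENNReal.tsum_mul_left]
              refine ENNReal.tsum_le_tsum fun y => ?_
              rw [← mul_assoc, ← ENNReal.mul_rpow_of_nonneg _ _ (by norm_num)]
              exact mul_le_mul_left (ENNReal.rpow_le_rpow (he i y) (by norm_num)) _
  refine (ENNReal.tsum_le_tsum h1).trans_eq ?_
  rw [ENNReal.tsum_mul_left, ENNReal.tsum_mul_left, ENNReal.tsum_comm]
  congr 2
  refine tsum_congr fun y => ?_
  rw [ENNReal.tsum_mul_left, ENNReal.tsum_add]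

/-! ### Unit boxes and weighted Hilbert–Schmidt norms. -/

section Position

open scoped InnerProductSpace

variable {d : ℕ} {μ : Measure (Fin d → ℝ)}

theorem enorm_sq_eq_lintegral (f : L2 μ) : ‖f‖ₑ ^ 2 = ∫⁻ x, ‖f x‖ₑ ^ 2 ∂μ := by
  rw [Lp.enorm_def, eLpNorm_eq_lintegral_rpow_enorm_toReal two_ne_zero ENNReal.ofNat_ne_top,
    ← ENNReal.rpow_two, ← ENNReal.rpow_mul]
  simp

theorem coeFn_chi (u : Fin d → ℤ) (f : L2 μ) :
    (chi μ u f : (Fin d → ℝ) → ℂ) =ᵐ[μ] (box u).indicator f := by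
  have h : chi μ u f = ((Lp.memLp f).indicator (measurableSet_box u)).toLp := rfl
  rw [h]
  exact MemLp.coeFn_toLp _

theorem enorm_chi_sq (u : Fin d → ℤ) (f : L2 μ) :
    ‖chi μ u f‖ₑ ^ 2 = ∫⁻ x in box u, ‖f x‖ₑ ^ 2 ∂μ := by
  rw [enorm_sq_eq_lintegral, ← lintegral_indicator (measurableSet_box u)]
  refine lintegral_congr_ae ?_
  filter_upwards [coeFn_chi u f] with x hx
  rw [hx]
  by_cases h : x ∈ box u <;> simp [h]

theorem adjoint_chi (u : Fin d → ℤ) :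
    ContinuousLinearMap.adjoint (chi μ u) = chi μ u := by
  rw [eq_comm, ContinuousLinearMap.eq_adjoint_iff]
  intro f g
  rw [L2.inner_def, L2.inner_def]
  refine integral_congr_ae ?_
  filter_upwards [coeFn_chi u f, coeFn_chi u g] with x h1 h2
  rw [h1, h2]
  by_cases h : x ∈ box u <;> simp [h]

theorem hsNorm_chi_comp_sq (A : L2 μ →L[ℂ] L2 μ) (u : Fin d → ℤ) :
    hsNorm (chi μ u ∘L A) ^ 2 = ∑' i, ∫⁻ x in box u, ‖A (basis (L2 μ) i) x‖ₑ ^ 2 ∂μ := by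
  rw [hsNorm_sq]
  exact tsum_congr fun i => enorm_chi_sq u _

theorem mem_box_iff {u : Fin d → ℤ} {x : Fin d → ℝ} : x ∈ box u ↔ ∀ i, |x i - u i| < 1 / 2 := by
  rw [box, Metric.mem_ball, dist_pi_lt_iff (by norm_num)]
  rfl

theorem pairwise_disjoint_box : Pairwise (Function.onFun Disjoint (box (d := d))) := by
  intro u v huv
  refine Set.disjoint_left.mpr fun x hx hy => huv ?_
  rw [mem_box_iff] at hx hy
  ext i
  have h1 := abs_lt.mp (hx i)
  have h2 := abs_lt.mp (hy i)
  have h3 : (u i : ℝ) < v i + 1 := by linarith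
  have h4 : (v i : ℝ) < u i + 1 := by linarith
  have h3' : u i < v i + 1 := by exact_mod_cast h3
  have h4' : v i < u i + 1 := by exact_mod_cast h4
  omega

theorem pt_mem_box_iff {u v : Fin d → ℤ} : pt v ∈ box u ↔ u = v := by
  refine ⟨fun h => ?_, fun h => h ▸ Metric.mem_ball_self (by norm_num)⟩
  by_contra hne
  exact Set.disjoint_left.mp (pairwise_disjoint_box hne) h (Metric.mem_ball_self (by norm_num))

/-- The open boxes miss only points with a half-integer coordinate: countably many Lebesgue-null
hyperplanes, which avoid the lattice points. -/
theorem measure_compl_iUnion_box (hμ : μ = volume ∨ μ = latticeMeasure d) :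
    μ (⋃ u, box u)ᶜ = 0 := by
  rcases hμ with rfl | rfl
  · have hsub : (⋃ u : Fin d → ℤ, box u)ᶜ ⊆
        ⋃ i : Fin d, ⋃ n : ℤ, {x : Fin d → ℝ | x i = n + 1 / 2} := by
      intro x hx
      by_contra hc
      simp only [Set.mem_iUnion, Set.mem_ofPred_eq, not_exists] at hc
      refine hx (Set.mem_iUnion.mpr ⟨fun i => ⌊x i + 1 / 2⌋, mem_box_iff.mpr fun i => ?_⟩)
      have h1 := Int.floor_le (x i + 1 / 2)
      have h2 := Int.lt_floor_add_one (x i + 1 / 2)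
      have h3 := hc i (⌊x i + 1 / 2⌋ - 1)
      push_cast at h3
      rw [abs_lt]
      refine ⟨lt_of_le_of_ne (by linarith) fun h => h3 (by linarith), by linarith⟩
    refine measure_mono_null hsub (measure_iUnion_null fun i => measure_iUnion_null fun n => ?_)
    exact Measure.pi_hyperplane _ i _
  · have hm : MeasurableSet (⋃ u : Fin d → ℤ, box u)ᶜ :=
      (MeasurableSet.iUnion fun u => measurableSet_box u).compl
    rw [latticeMeasure, Measure.sum_apply _ hm, ENNReal.tsum_eq_zero]
    intro n
    rw [Measure.dirac_apply' _ hm, Set.indicator_of_notMem]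
    exact fun h => h (Set.mem_iUnion.mpr ⟨n, pt_mem_box_iff.mpr rfl⟩)

theorem lintegral_eq_tsum_box (hμ : μ = volume ∨ μ = latticeMeasure d)
    (g : (Fin d → ℝ) → ℝ≥0∞) : ∫⁻ x, g x ∂μ = ∑' u, ∫⁻ x in box u, g x ∂μ := by
  rw [← lintegral_iUnion measurableSet_box pairwise_disjoint_box,
    ← setLIntegral_univ, Measure.restrict_congr_set]
  exact (ae_eq_univ.mpr (measure_compl_iUnion_box hμ)).symm

/-- Pythagoras over the boxes; with A = P_l χ_u it supplies s_l(u)² = ∑_y a_l(y)². -/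
theorem tsum_hsNorm_chi_comp_sq (hμ : μ = volume ∨ μ = latticeMeasure d) (A : L2 μ →L[ℂ] L2 μ) :
    ∑' u, hsNorm (chi μ u ∘L A) ^ 2 = hsNorm A ^ 2 := by
  simp_rw [hsNorm_chi_comp_sq]
  rw [ENNReal.tsum_comm, hsNorm_sq]
  refine tsum_congr fun i => ?_
  rw [enorm_sq_eq_lintegral, lintegral_eq_tsum_box hμ]

theorem weightedHSSq_eq_tsum (hμ : μ = volume ∨ μ = latticeMeasure d)
    (w : (Fin d → ℝ) → ℝ) (A : L2 μ →L[ℂ] L2 μ) : weightedHSSq μ w A =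
      ∑' u, ∑' i, ∫⁻ x in box u, ENNReal.ofReal (w x) * ‖A (basis (L2 μ) i) x‖ₑ ^ 2 ∂μ := by
  rw [weightedHSSq, ENNReal.tsum_comm]
  exact tsum_congr fun i => lintegral_eq_tsum_box hμ _

theorem weightedHSSq_le_tsum (hμ : μ = volume ∨ μ = latticeMeasure d)
    {w : (Fin d → ℝ) → ℝ} {c : (Fin d → ℤ) → ℝ} (hw : ∀ u, ∀ x ∈ box u, w x ≤ c u)
    (A : L2 μ →L[ℂ] L2 μ) :
    weightedHSSq μ w A ≤ ∑' u, ENNReal.ofReal (c u) * hsNorm (chi μ u ∘L A) ^ 2 := by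
  rw [weightedHSSq_eq_tsum hμ]
  refine ENNReal.tsum_le_tsum fun u => ?_
  rw [hsNorm_chi_comp_sq, ← ENNReal.tsum_mul_left]
  refine ENNReal.tsum_le_tsum fun i => ?_
  rw [← lintegral_const_mul' _ _ ENNReal.ofReal_ne_top]
  refine setLIntegral_mono' (measurableSet_box u) fun x hx => ?_
  gcongr
  exact hw u x hx

theorem mul_hsNorm_le_weightedHSSq {w : (Fin d → ℝ) → ℝ} {c : ℝ} {u : Fin d → ℤ}
    (hw : ∀ x ∈ box u, c ≤ w x) (A : L2 μ →L[ℂ] L2 μ) :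
    ENNReal.ofReal c * hsNorm (chi μ u ∘L A) ^ 2 ≤ weightedHSSq μ w A := by
  rw [weightedHSSq, hsNorm_chi_comp_sq, ← ENNReal.tsum_mul_left]
  refine ENNReal.tsum_le_tsum fun i => ?_
  rw [← lintegral_const_mul' _ _ ENNReal.ofReal_ne_top]
  refine (setLIntegral_mono' (measurableSet_box u) fun x hx => ?_).trans
    (setLIntegral_le_lintegral _ _)
  gcongr
  exact hw x hx

theorem norm_pt_sub_rpow_le {x u : Fin d → ℤ} {y : Fin d → ℝ} (hy : y ∈ box x) {ζ : ℝ}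
    (hζ : ζ ∈ Set.Ioc (0 : ℝ) 1) : ‖pt x - pt u‖ ^ ζ ≤ ‖y - pt u‖ ^ ζ + 1 := by
  have h1 : ‖pt x - pt u‖ ≤ ‖y - pt u‖ + 1 := by
    have h2 : dist y (pt x) < 1 / 2 := hy
    have h3 := dist_triangle_left (pt x) (pt u) y
    rw [← dist_eq_norm, ← dist_eq_norm]
    linarith
  calc ‖pt x - pt u‖ ^ ζ ≤ (‖y - pt u‖ + 1) ^ ζ := by gcongr; exact hζ.1.le
    _ ≤ ‖y - pt u‖ ^ ζ + 1 ^ ζ :=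
        Real.rpow_add_le_add_rpow (norm_nonneg _) zero_le_one hζ.1.le hζ.2
    _ = _ := by rw [Real.one_rpow]

theorem norm_sub_pt_rpow_le {x u : Fin d → ℤ} {y : Fin d → ℝ} (hy : y ∈ box x) {ζ : ℝ}
    (hζ : ζ ∈ Set.Ioc (0 : ℝ) 1) : ‖y - pt u‖ ^ ζ ≤ ‖pt x - pt u‖ ^ ζ + 1 := by
  have h1 : ‖y - pt u‖ ≤ ‖pt x - pt u‖ + 1 := by
    have h2 : dist y (pt x) < 1 / 2 := hy
    have h3 := dist_triangle y (pt x) (pt u)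
    rw [← dist_eq_norm, ← dist_eq_norm]
    linarith
  calc ‖y - pt u‖ ^ ζ ≤ (‖pt x - pt u‖ + 1) ^ ζ := by gcongr; exact hζ.1.le
    _ ≤ ‖pt x - pt u‖ ^ ζ + 1 ^ ζ :=
        Real.rpow_add_le_add_rpow (norm_nonneg _) zero_le_one hζ.1.le hζ.2
    _ = _ := by rw [Real.one_rpow]

theorem norm_pt_rpow_le (y u : Fin d → ℤ) {ζ : ℝ} (hζ : ζ ∈ Set.Ioc (0 : ℝ) 1) :
    ‖pt y‖ ^ ζ ≤ ‖pt u‖ ^ ζ + ‖pt y - pt u‖ ^ ζ := by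
  calc ‖pt y‖ ^ ζ ≤ (‖pt u‖ + ‖pt y - pt u‖) ^ ζ := by
        gcongr
        · exact hζ.1.le
        · exact norm_le_norm_add_norm_sub' _ _
    _ ≤ _ := Real.rpow_add_le_add_rpow (norm_nonneg _) (norm_nonneg _) hζ.1.le hζ.2

end Position

/-! ### Stretched exponentials on ℤᵈ. -/

theorem tsum_prod_pi_eq_pow {α : Type*} (f : α → ℝ≥0∞) (d : ℕ) :
    ∑' n : Fin d → α, ∏ i, f (n i) = (∑' k, f k) ^ d := by
  induction d with
  | zero => simp
  | succ d ih =>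
    rw [← (Fin.consEquiv fun _ => α).tsum_eq]
    simp only [Fin.consEquiv_apply, Fin.prod_univ_succ, Fin.cons_zero, Fin.cons_succ]
    rw [ENNReal.tsum_prod (f := fun (k : α) (n : Fin d → α) => f k * ∏ i, f (n i))]
    simp only [ENNReal.tsum_mul_left, ENNReal.tsum_mul_right, ih]
    rw [pow_succ']

theorem summable_exp_neg_mul_abs_rpow {c ζ : ℝ} (hc : 0 < c) (hζ : 0 < ζ) :
    Summable fun k : ℤ => Real.exp (-c * |(k : ℝ)| ^ ζ) := by
  have h : Summable fun k : ℕ => Real.exp (-c * (k : ℝ) ^ ζ) := by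
    have h1 := isLittleO_exp_neg_mul_rpow_atTop hc (-2 / ζ)
    have h2 := h1.comp_tendsto ((tendsto_rpow_atTop hζ).comp tendsto_natCast_atTop_atTop)
    refine summable_of_isBigO_nat (g := fun n : ℕ => (n : ℝ) ^ (-2 : ℝ))
      (Real.summable_nat_rpow.mpr (by norm_num)) (h2.isBigO.congr_right fun n => ?_)
    simp only [Function.comp_apply]
    rw [← Real.rpow_mul (Nat.cast_nonneg n), mul_div_cancel₀ _ hζ.ne']
  refine Summable.of_nat_of_neg ?_ ?_ <;> simpa using h

/-- The maximum norm dominates the average over coordinates, ‖n‖^ζ ≥ (1/d) ∑ |n_i|^ζ, so the sum is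
bounded by a d-th power of a one-dimensional one. For d = 0 there is a single term. -/
theorem tsum_exp_neg_mul_norm_rpow_lt_top (d : ℕ) {c ζ : ℝ} (hc : 0 < c) (hζ : 0 < ζ) :
    ∑' n : Fin d → ℤ, ENNReal.ofReal (Real.exp (-c * ‖pt n‖ ^ ζ)) < ⊤ := by
  rcases Nat.eq_zero_or_pos d with rfl | hd
  · simp
  have hd' : (0 : ℝ) < d := by exact_mod_cast hd
  have h1 : ∀ n : Fin d → ℤ, ENNReal.ofReal (Real.exp (-c * ‖pt n‖ ^ ζ)) ≤
      ∏ i, ENNReal.ofReal (Real.exp (-(c / d) * |((n i : ℤ) : ℝ)| ^ ζ)) := by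
    intro n
    rw [← ENNReal.ofReal_prod_of_nonneg fun _ _ => (Real.exp_pos _).le, ← Real.exp_sum,
      ← Finset.mul_sum]
    refine ENNReal.ofReal_le_ofReal (Real.exp_le_exp.mpr ?_)
    have h2 : ∑ i, |((n i : ℤ) : ℝ)| ^ ζ ≤ d * ‖pt n‖ ^ ζ := by
      refine (Finset.sum_le_card_nsmul _ _ (‖pt n‖ ^ ζ) fun i _ => ?_).trans_eq (by simp)
      gcongr
      exact norm_le_pi_norm (pt n) i
    calc -c * ‖pt n‖ ^ ζ = -(c / d) * (d * ‖pt n‖ ^ ζ) := by field_simp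
      _ ≤ _ := mul_le_mul_of_nonpos_left h2 (neg_nonpos.mpr (by positivity))
  refine (ENNReal.tsum_le_tsum h1).trans_lt ?_
  rw [tsum_prod_pi_eq_pow fun k : ℤ => ENNReal.ofReal (Real.exp (-(c / d) * |(k : ℝ)| ^ ζ))]
  refine ENNReal.pow_lt_top ?_
  rw [← ENNReal.ofReal_tsum_of_nonneg (fun _ => (Real.exp_pos _).le)
    (summable_exp_neg_mul_abs_rpow (by positivity) hζ)]
  exact ENNReal.ofReal_lt_top

theorem tsum_exp_neg_mul_norm_sub_rpow (d : ℕ) (c ζ : ℝ) (u : Fin d → ℤ) :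
    ∑' n : Fin d → ℤ, ENNReal.ofReal (Real.exp (-c * ‖pt n - pt u‖ ^ ζ)) =
      ∑' n : Fin d → ℤ, ENNReal.ofReal (Real.exp (-c * ‖pt n‖ ^ ζ)) := by
  rw [← (Equiv.subRight u).tsum_eq fun n =>
    ENNReal.ofReal (Real.exp (-c * ‖pt n‖ ^ ζ))]
  refine tsum_congr fun n => ?_
  have : pt n - pt u = pt (n - u) := by ext; simp [pt]
  rw [this]
  rfl

/-- Powers of `1 + (r + 1)²` grow slower than stretched exponentials. -/
theorem exists_rpow_le_exp {κ δ ζ : ℝ} (hκ : 0 < κ) (hδ : 0 < δ) (hζ : ζ ∈ Set.Ioc (0 : ℝ) 1) :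
    ∃ D : ℝ, 0 ≤ D ∧ ∀ r : ℝ, 0 ≤ r → (1 + (r + 1) ^ 2) ^ κ ≤ D * Real.exp (δ * r ^ ζ) := by
  obtain ⟨hζ0, hζ1⟩ := hζ
  set p : ℝ := 2 * κ / ζ with hp
  have hp0 : 0 < p := by positivity
  -- In the variable x = r^ζ, subadditivity gives 1 + r ≤ (1 + x)^{1/ζ}, leaving (1 + x)^p. The
  -- constant comes from the p-th power of 1 + x ≤ (p/δ) e^{(δ/p)(1 + x)}.
  refine ⟨2 ^ (2 * κ) * ((p / δ) ^ p * Real.exp δ), by positivity, fun r hr => ?_⟩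
  set x := r ^ ζ with hx
  have hx0 : 0 ≤ x := by positivity
  have h1 : 1 + r ≤ (1 + x) ^ (1 / ζ) := by
    have h2 : (1 + r) ^ ζ ≤ 1 + x := by
      have := Real.rpow_add_le_add_rpow zero_le_one hr hζ0.le hζ1
      rwa [Real.one_rpow] at this
    calc 1 + r = ((1 + r) ^ ζ) ^ (1 / ζ) := by
          rw [← Real.rpow_mul (by positivity), mul_one_div_cancel hζ0.ne', Real.rpow_one]
      _ ≤ _ := by gcongr
  have h3 : 1 + x ≤ p / δ * Real.exp (δ / p * (1 + x)) := by
    have := Real.add_one_le_exp (δ / p * (1 + x))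
    calc 1 + x = p / δ * (δ / p * (1 + x)) := by field_simp
      _ ≤ _ := by
        gcongr
        linarith
  calc (1 + (r + 1) ^ 2) ^ κ ≤ ((2 * (1 + r)) ^ (2 : ℝ)) ^ κ := by
        gcongr
        rw [Real.rpow_two]
        nlinarith
    _ = 2 ^ (2 * κ) * (1 + r) ^ (2 * κ) := by
        rw [← Real.rpow_mul (by positivity), Real.mul_rpow (by positivity) (by positivity)]
    _ ≤ 2 ^ (2 * κ) * ((1 + x) ^ (1 / ζ)) ^ (2 * κ) := by gcongr
    _ = 2 ^ (2 * κ) * (1 + x) ^ p := by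
        rw [← Real.rpow_mul (by positivity), hp]
        congr 2
        ring
    _ ≤ 2 ^ (2 * κ) * (p / δ * Real.exp (δ / p * (1 + x))) ^ p := by gcongr
    _ = 2 ^ (2 * κ) * ((p / δ) ^ p * Real.exp (δ * (1 + x))) := by
        rw [Real.mul_rpow (by positivity) (by positivity), ← Real.exp_mul]
        congr 3
        field_simp
    _ = _ := by
        rw [mul_add, mul_one, Real.exp_add]
        ring


/-! ### Square sums of eigenprojections on a box. -/

section Position

open scoped InnerProductSpace

variable {d : ℕ} {μ : Measure (Fin d → ℝ)}

theorem latticeMeasure_restrict_box (u : Fin d → ℤ) :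
    (latticeMeasure d).restrict (box u) = Measure.dirac (pt u) := by
  ext s hs
  have hsu := hs.inter (measurableSet_box u)
  rw [Measure.restrict_apply hs, latticeMeasure, Measure.sum_apply _ hsu, tsum_eq_single u]
  · rw [Measure.dirac_apply' _ hsu, Measure.dirac_apply' _ hs]
    by_cases h : pt u ∈ s <;> simp [h, pt_mem_box_iff]
  · intro v hv
    rw [Measure.dirac_apply' _ hsu, Set.indicator_of_notMem]
    exact fun h => hv (pt_mem_box_iff.mp h.2).symm

/-- A box contains exactly one atom of the counting measure, so χ_u has rank one. -/
theorem exists_chi_latticeMeasure_eq (u : Fin d → ℤ) : ∃ e : L2 (latticeMeasure d), ‖e‖ₑ ≤ 1 ∧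
    ∀ f, chi (latticeMeasure d) u f = ⟪e, f⟫_ℂ • e := by
  have hbox : latticeMeasure d (box u) = 1 := by
    rw [← Measure.restrict_apply_univ, latticeMeasure_restrict_box, measure_univ]
  have htop : latticeMeasure d (box u) ≠ ⊤ := by simp [hbox]
  refine ⟨indicatorConstLp 2 (measurableSet_box u) htop (1 : ℂ), ?_, fun f => ?_⟩
  · rw [← ofReal_norm, norm_indicatorConstLp two_ne_zero ENNReal.ofNat_ne_top, measureReal_def,
      hbox]
    simp
  · rw [L2.inner_indicatorConstLp_one, latticeMeasure_restrict_box, integral_dirac]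
    refine Lp.ext ?_
    have hres : ∀ᵐ x ∂(latticeMeasure d).restrict (box u), f x = f (pt u) := by
      rw [latticeMeasure_restrict_box, ae_dirac_eq]
      rfl
    rw [ae_restrict_iff' (measurableSet_box u)] at hres
    filter_upwards [coeFn_chi u f, hres,
      Lp.coeFn_smul (f (pt u)) (indicatorConstLp 2 (measurableSet_box u) htop (1 : ℂ)),
      indicatorConstLp_coeFn (p := 2) (hs := measurableSet_box u) (hμs := htop) (c := (1 : ℂ))]
      with x h1 h2 h3 h4
    rw [h1, h3, Pi.smul_apply, h4]
    by_cases h : x ∈ box u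
    · simp [h, h2 h]
    · simp [h]

variable {H : L2 μ →ₗ.[ℂ] L2 μ} {I : Set ℝ}

theorem hsNorm_eigenProj_comp_chi (lam : ℝ) (u : Fin d → ℤ) :
    hsNorm (eigenProj H lam ∘L chi μ u) = hsNorm (chi μ u ∘L eigenProj H lam) := by
  rw [← hsNorm_adjoint, ContinuousLinearMap.adjoint_comp, adjoint_chi, adjoint_eigenProj]

/-- Since P_l χ_u = ⟨e, ·⟩ P_l e, Bessel's inequality for e bounds the sum; this replaces the trace
condition on the lattice. -/
theorem tsum_hsNorm_eigenProj_lattice_le {H : L2 (latticeMeasure d) →ₗ.[ℂ] L2 (latticeMeasure d)}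
    (hH : IsSelfAdjoint H) (u : Fin d → ℤ) :
    ∑' lam, hsNorm (eigenProj H lam ∘L chi (latticeMeasure d) u) ^ 2 ≤ 1 := by
  obtain ⟨e, he, hchi⟩ := exists_chi_latticeMeasure_eq u
  have h1 : ∀ lam, hsNorm (eigenProj H lam ∘L chi (latticeMeasure d) u) ^ 2 ≤
      ‖eigenProj H lam e‖ₑ ^ 2 := by
    intro lam
    have h2 : ∑' i, ‖⟪e, basis (L2 (latticeMeasure d)) i⟫_ℂ‖ₑ ^ 2 ≤ 1 := by
      have h3 := tsum_enorm_inner_sq (basis (L2 (latticeMeasure d))) e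
      simp only [← ofReal_norm, norm_inner_symm] at h3 ⊢
      rw [h3, ofReal_norm]
      exact pow_le_one₀ zero_le he
    rw [hsNorm_sq]
    simp only [ContinuousLinearMap.comp_apply, hchi, map_smul, enorm_smul, mul_pow]
    rw [ENNReal.tsum_mul_right]
    exact mul_le_of_le_one_left zero_le h2
  calc _ ≤ ∑' lam, ‖eigenProj H lam e‖ₑ ^ 2 := ENNReal.tsum_le_tsum h1
    _ ≤ ‖e‖ₑ ^ 2 := tsum_enorm_eigenProj_sq_le hH e
    _ ≤ 1 := pow_le_one₀ zero_le he

/-- For Lebesgue measure, the weight (1 + |x|²)^{-κ} on the box at y is at least an inverse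
polynomial in |y|, and the polynomial loss is absorbed by the stretched exponential. -/
theorem exists_tsum_hsNorm_eigenProj_le (hμ : μ = volume ∨ μ = latticeMeasure d)
    (hH : IsSelfAdjoint H) (hfin : μ = volume → LocallyTraceFinite μ H I) {J : Set ℝ}
    (hJ : IsCompact J) (hJI : J ⊆ I) {δ ζ : ℝ} (hδ : 0 < δ) (hζ : ζ ∈ Set.Ioc (0 : ℝ) 1) :
    ∃ D : ℝ, 0 ≤ D ∧ ∀ y : Fin d → ℤ, ∑' lam : J, hsNorm (eigenProj H lam ∘L chi μ y) ^ 2 ≤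
      ENNReal.ofReal (D * Real.exp (δ * ‖pt y‖ ^ ζ)) := by
  by_cases hv : μ = volume
  · obtain ⟨κ, hκ, hκ'⟩ := hfin hv
    have hκ0 : 0 < κ := lt_of_le_of_lt (by positivity) hκ
    obtain ⟨D, hD, hD'⟩ := exists_rpow_le_exp hκ0 hδ hζ
    set K := ∑' lam : J, weightedHSSq μ (fun x => (1 + ‖x‖ ^ 2) ^ (-κ)) (eigenProj H lam) with hK
    have hKtop : K ≠ ⊤ := (hκ' J hJ hJI).ne
    refine ⟨K.toReal * D, by positivity, fun y => ?_⟩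
    have h1 : ∀ lam : J, hsNorm (eigenProj H lam ∘L chi μ y) ^ 2 ≤
        ENNReal.ofReal ((1 + (‖pt y‖ + 1) ^ 2) ^ κ) *
          weightedHSSq μ (fun x => (1 + ‖x‖ ^ 2) ^ (-κ)) (eigenProj H lam) := by
      intro lam
      have hc : ∀ x ∈ box y, (1 + (‖pt y‖ + 1) ^ 2) ^ (-κ) ≤ (1 + ‖x‖ ^ 2) ^ (-κ) := by
        intro x hx
        have h2 : dist x (pt y) < 1 / 2 := hx
        have h3 : ‖x‖ ≤ ‖pt y‖ + 1 := by
          have := norm_le_norm_add_norm_sub' x (pt y)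
          rw [← dist_eq_norm] at this
          linarith
        exact Real.rpow_le_rpow_of_nonpos (by positivity) (by gcongr) (by linarith)
      have h4 := mul_hsNorm_le_weightedHSSq hc (eigenProj H (lam : ℝ))
      rw [hsNorm_eigenProj_comp_chi]
      calc _ = ENNReal.ofReal ((1 + (‖pt y‖ + 1) ^ 2) ^ κ) *
            (ENNReal.ofReal ((1 + (‖pt y‖ + 1) ^ 2) ^ (-κ)) *
              hsNorm (chi μ y ∘L eigenProj H lam) ^ 2) := by
            rw [← mul_assoc, ← ENNReal.ofReal_mul (by positivity),
              ← Real.rpow_add (by positivity)]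
            simp
        _ ≤ _ := by gcongr
    refine (ENNReal.tsum_le_tsum h1).trans ?_
    rw [ENNReal.tsum_mul_left, ← hK, ← ENNReal.ofReal_toReal hKtop,
      ← ENNReal.ofReal_mul (by positivity), mul_comm, mul_assoc]
    refine ENNReal.ofReal_le_ofReal ?_
    rw [ENNReal.toReal_ofReal ENNReal.toReal_nonneg]
    gcongr
    exact hD' _ (norm_nonneg _)
  · obtain rfl := hμ.resolve_left hv
    refine ⟨1, zero_le_one, fun y => ?_⟩
    calc _ ≤ ∑' lam : ℝ, hsNorm (eigenProj H lam ∘L chi (latticeMeasure d) y) ^ 2 :=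
          ENNReal.tsum_comp_le_tsum_of_injective Subtype.val_injective _
      _ ≤ 1 := tsum_hsNorm_eigenProj_lattice_le hH y
      _ ≤ _ := by
          rw [← ENNReal.ofReal_one, one_mul]
          exact ENNReal.ofReal_le_ofReal (Real.one_le_exp (by positivity))

end Position

/-! ### From SULP to SUDL and to the moment bounds. -/

section Localization

variable {d : ℕ} {μ : Measure (Fin d → ℝ)} {H : L2 μ →ₗ.[ℂ] L2 μ} {I : Set ℝ}

theorem hasSum_evol_apply (hH : IsSelfAdjoint H) (hpp : HasPurePointSpectrumIn H I)
    {X : ℝ → ℝ} (hX : X ∈ TestFun I) (t : ℝ) (f : L2 μ) :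
    HasSum (fun l : ℝ => (Complex.exp (-(Complex.I * t * l)) * X l) • eigenProj H l f)
      (evol H X t f) := by
  obtain ⟨h1, h2, h3, -⟩ := hX
  have hsub : tsupport (fun l : ℝ => Complex.exp (-(Complex.I * t * l)) * (X l : ℂ)) ⊆
      tsupport X := by
    refine closure_mono fun l hl => ?_
    simp only [Function.mem_support, ne_eq, mul_eq_zero, Complex.exp_ne_zero, false_or,
      Complex.ofReal_eq_zero] at hl ⊢
    exact hl
  refine hasSum_funCalc_apply hH hpp (I := I) ?_ ?_ (hsub.trans h3) f
  · have := h1.continuous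
    fun_prop
  · exact h2.of_isClosed_subset (isClosed_tsupport _) hsub

theorem enorm_exp_mul (t l x : ℝ) (hx : 0 ≤ x) :
    ‖Complex.exp (-(Complex.I * t * l)) * (x : ℂ)‖ₑ = ENNReal.ofReal x := by
  rw [← ofReal_norm, norm_mul, Complex.norm_exp, Complex.norm_real, Real.norm_of_nonneg hx]
  simp

/-- The phases have modulus one, so t disappears. The sum runs over the compact support of X, where
`exists_tsum_hsNorm_eigenProj_le` applies. -/
theorem hsNorm_evol_le (hH : IsSelfAdjoint H) (hpp : HasPurePointSpectrumIn H I)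
    {X : ℝ → ℝ} (hX : X ∈ TestFun I) (t : ℝ) (x u : Fin d → ℤ) :
    hsNorm (chi μ x ∘L evol H X t ∘L chi μ u) ≤ ∑' l : tsupport X,
      ENNReal.ofReal (X l) * hsNorm (chi μ x ∘L eigenProj H l ∘L chi μ u) := by
  have h1 : hsNorm (chi μ x ∘L evol H X t ∘L chi μ u) ≤ ∑' l : ℝ,
      hsNorm ((Complex.exp (-(Complex.I * t * l)) * X l) •
        (chi μ x ∘L eigenProj H l ∘L chi μ u)) := by
    refine hsNorm_le_tsum fun f => ?_
    have := (hasSum_evol_apply hH hpp hX t (chi μ u f)).mapL (chi μ x)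
    simpa only [map_smul, smul_apply, ContinuousLinearMap.comp_apply] using this
  refine h1.trans ?_
  simp only [hsNorm_smul, enorm_exp_mul _ _ _ (hX.2.2.2 _)]
  rw [← tsum_subtype_eq_of_support_subset]
  intro l hl
  refine subset_tsupport X fun h0 => hl ?_
  simp [h0]

theorem hsNorm_comp_eigenProj_le (l : ℝ) (x u : Fin d → ℤ) :
    hsNorm (chi μ x ∘L eigenProj H l ∘L chi μ u) ≤
      hsNorm (eigenProj H l ∘L chi μ x) * hsNorm (eigenProj H l ∘L chi μ u) := by
  have : chi μ x ∘L eigenProj H l ∘L chi μ u =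
      (chi μ x ∘L eigenProj H l) ∘L (eigenProj H l ∘L chi μ u) := by
    nth_rewrite 1 [← eigenProj_comp_self l]
    rfl
  rw [this, hsNorm_eigenProj_comp_chi l x]
  exact hsNorm_comp_le_mul _ _

theorem TestFun.exists_bound {X : ℝ → ℝ} (hX : X ∈ TestFun I) :
    ∃ M : ℝ, 0 ≤ M ∧ ∀ l, X l ≤ M := by
  obtain ⟨M, hM⟩ := hX.2.1.exists_bound_of_continuous hX.1.continuous
  exact ⟨M, (norm_nonneg _).trans (hM 0), fun l => (le_abs_self _).trans (hM l)⟩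

theorem SULP.sudl (hμ : μ = volume ∨ μ = latticeMeasure d) (hH : IsSelfAdjoint H)
    (hpp : HasPurePointSpectrumIn H I) (hfin : μ = volume → LocallyTraceFinite μ H I)
    (h : SULP μ H I) : SUDL μ H I := by
  obtain ⟨ζ, hζ, σ, hσ, h⟩ := h
  refine ⟨ζ, hζ, σ / 2, by positivity, fun ε hε X hX => ?_⟩
  obtain ⟨C₀, hC₀⟩ := h ε hε X hX
  obtain ⟨M, hM0, hM⟩ := TestFun.exists_bound hX
  -- The powers 1/2 and 1/4 of the SULP bound use 3ε/4, leaving ε/4 for the growth of the square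
  -- sums. In e^{δ|y|^ζ} ≤ e^{δ|u|^ζ} e^{δ|y-u|^ζ} the last factor costs at most σ/8 of the
  -- available decay σ/4; the remaining σ/8 makes the sum over y converge.
  set δ := min (ε / 4) (σ / 8) with hδ
  have hδ0 : 0 < δ := by positivity
  obtain ⟨D, hD0, hD⟩ := exists_tsum_hsNorm_eigenProj_le hμ hH hfin hX.2.1 hX.2.2.1 hδ0 hζ
  have hS : ∑' n : Fin d → ℤ, ENNReal.ofReal (Real.exp (-(σ / 8) * ‖pt n‖ ^ ζ)) ≠ ⊤ :=
    (tsum_exp_neg_mul_norm_rpow_lt_top d (by positivity) hζ.1).ne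
  set S := ∑' n : Fin d → ℤ, ENNReal.ofReal (Real.exp (-(σ / 8) * ‖pt n‖ ^ ζ)) with hSdef
  set C := max C₀ 0 with hC
  have hC0 : 0 ≤ C := le_max_right _ _
  -- The exponent 3/4 is 1/2 + 1/4, and 2D collects the square sums at y and at u.
  refine ⟨C ^ (3 / 4 : ℝ) * M ^ (1 / 4 : ℝ) * (S.toReal * (2 * D)), fun x u => ?_⟩
  have hCe : ∀ y : Fin d → ℤ, ∀ l : tsupport X,
      ENNReal.ofReal (X l) * hsNorm (chi μ y ∘L eigenProj H l ∘L chi μ u) ≤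
        ENNReal.ofReal (C * Real.exp (ε * ‖pt u‖ ^ ζ)) *
          ENNReal.ofReal (Real.exp (-σ * ‖pt y - pt u‖ ^ ζ)) := by
    intro y l
    refine ((le_iSup (fun lam : ℝ => ENNReal.ofReal (X lam) *
      hsNorm (chi μ y ∘L eigenProj H lam ∘L chi μ u)) l).trans (hC₀ y u)).trans ?_
    rw [← ENNReal.ofReal_mul (by positivity)]
    refine ENNReal.ofReal_le_ofReal ?_
    gcongr
    exact le_max_left _ _
  have hfinite : ∀ l : tsupport X, hsNorm (eigenProj H l ∘L chi μ u) ≠ ⊤ := by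
    intro l htop
    have h1 := (ENNReal.le_tsum l).trans (hD u)
    rw [htop] at h1
    simp at h1
  refine iSup_le fun t => (hsNorm_evol_le hH hpp hX t x u).trans ?_
  refine (tsum_mul_le_of_localized (M := ENNReal.ofReal M)
    (e := fun y => ENNReal.ofReal (Real.exp (-σ * ‖pt y - pt u‖ ^ ζ)))
    (s := fun (l : tsupport X) (y : Fin d → ℤ) => hsNorm (eigenProj H l ∘L chi μ y))
    (a := fun (l : tsupport X) (y : Fin d → ℤ) =>
      hsNorm (chi μ y ∘L eigenProj H l ∘L chi μ u)) hfinite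
    (fun l => (tsum_hsNorm_chi_comp_sq hμ _).symm)
    (fun l y => hsNorm_comp_eigenProj_le (l : ℝ) y u)
    (fun l => ENNReal.ofReal_le_ofReal (hM l)) (fun l y => hCe y l) x).trans ?_
  have hterm : ∀ y : Fin d → ℤ, (ENNReal.ofReal (C * Real.exp (ε * ‖pt u‖ ^ ζ)) *
      ENNReal.ofReal (Real.exp (-σ * ‖pt y - pt u‖ ^ ζ))) ^ (1 / 4 : ℝ) *
      (∑' l : tsupport X, hsNorm (eigenProj H l ∘L chi μ y) ^ 2 +
        ∑' l : tsupport X, hsNorm (eigenProj H l ∘L chi μ u) ^ 2) ≤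
      ENNReal.ofReal (C ^ (1 / 4 : ℝ) * (2 * D) * Real.exp (ε / 2 * ‖pt u‖ ^ ζ)) *
        ENNReal.ofReal (Real.exp (-(σ / 8) * ‖pt y - pt u‖ ^ ζ)) := by
    intro y
    refine (mul_le_mul_right (add_le_add (hD y) (hD u)) _).trans ?_
    rw [← ENNReal.ofReal_mul (by positivity), ENNReal.ofReal_rpow_of_nonneg (by positivity)
      (by norm_num), ← ENNReal.ofReal_add (by positivity) (by positivity),
      ← ENNReal.ofReal_mul (by positivity), ← ENNReal.ofReal_mul (by positivity)]
    refine ENNReal.ofReal_le_ofReal ?_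
    have hy := norm_pt_rpow_le y u hζ
    have hr0 : 0 ≤ ‖pt y - pt u‖ ^ ζ := by positivity
    have hu0 : 0 ≤ ‖pt u‖ ^ ζ := by positivity
    generalize ‖pt y - pt u‖ ^ ζ = r at *
    generalize ‖pt u‖ ^ ζ = v at *
    generalize ‖pt y‖ ^ ζ = w at *
    have hδ1 : δ ≤ ε / 4 := min_le_left _ _
    have hδ2 : δ ≤ σ / 8 := min_le_right _ _
    have e1 : δ * w ≤ ε / 4 * v + σ / 8 * r := by nlinarith
    have e2 : δ * v ≤ ε / 4 * v + σ / 8 * r := by nlinarith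
    calc (C * Real.exp (ε * v) * Real.exp (-σ * r)) ^ (1 / 4 : ℝ) *
          (D * Real.exp (δ * w) + D * Real.exp (δ * v))
        ≤ (C * Real.exp (ε * v) * Real.exp (-σ * r)) ^ (1 / 4 : ℝ) *
          (D * Real.exp (ε / 4 * v + σ / 8 * r) + D * Real.exp (ε / 4 * v + σ / 8 * r)) := by
          gcongr
      _ = C ^ (1 / 4 : ℝ) * (2 * D) * (Real.exp (ε * v * (1 / 4)) * Real.exp (-σ * r * (1 / 4)) *
          Real.exp (ε / 4 * v + σ / 8 * r)) := by
          rw [Real.mul_rpow (by positivity) (by positivity),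
            Real.mul_rpow (by positivity) (by positivity), ← Real.exp_mul, ← Real.exp_mul]
          ring
      _ = _ := by
          rw [← Real.exp_add, ← Real.exp_add, mul_assoc _ (Real.exp _) (Real.exp _),
            ← Real.exp_add]
          congr 2
          ring
  refine (mul_le_mul_right (mul_le_mul_right (ENNReal.tsum_le_tsum hterm) _) _).trans ?_
  rw [ENNReal.tsum_mul_left, tsum_exp_neg_mul_norm_sub_rpow, ← hSdef,
    ← ENNReal.ofReal_toReal hS, ENNReal.toReal_ofReal ENNReal.toReal_nonneg,
    ← ENNReal.ofReal_mul (by positivity), ← ENNReal.ofReal_mul (by positivity),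
    ENNReal.ofReal_rpow_of_nonneg (by positivity) (by norm_num),
    ENNReal.ofReal_rpow_of_nonneg (by positivity) (by norm_num),
    ← ENNReal.ofReal_mul (by positivity), ← ENNReal.ofReal_mul (by positivity)]
  refine ENNReal.ofReal_le_ofReal (le_of_eq ?_)
  rw [Real.mul_rpow (by positivity) (by positivity),
    Real.mul_rpow (by positivity) (by positivity), ← Real.exp_mul, ← Real.exp_mul]
  have hCC : C ^ (3 / 4 : ℝ) = C ^ (1 / 2 : ℝ) * C ^ (1 / 4 : ℝ) := by
    rw [← Real.rpow_add_of_nonneg hC0 (by norm_num) (by norm_num)]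
    norm_num
  have hE : Real.exp (ε * ‖pt u‖ ^ ζ) =
      Real.exp (ε * ‖pt u‖ ^ ζ * (1 / 2)) * Real.exp (ε / 2 * ‖pt u‖ ^ ζ) := by
    rw [← Real.exp_add]
    congr 1
    ring
  have hE2 : Real.exp (-(σ / 2) * ‖pt x - pt u‖ ^ ζ) =
      Real.exp (-σ * ‖pt x - pt u‖ ^ ζ * (1 / 2)) := by
    congr 1
    ring
  rw [hCC, hE, hE2]
  ring

theorem SUDL.uniformMomentBound (hμ : μ = volume ∨ μ = latticeMeasure d)
    (h : SUDL μ H I) : UniformMomentBound μ H I := by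
  obtain ⟨ζ, hζ, σ, hσ, h⟩ := h
  refine ⟨σ, hσ, ζ, hζ, fun ε hε X hX => ?_⟩
  -- Squaring the SUDL bound doubles both exponents: ε/2 becomes ε, and 2σ pays for the weight σ
  -- with σ left to sum over boxes.
  obtain ⟨C₀, hC₀⟩ := h (ε / 2) (by positivity) X hX
  have hS : ∑' n : Fin d → ℤ, ENNReal.ofReal (Real.exp (-σ * ‖pt n‖ ^ ζ)) ≠ ⊤ :=
    (tsum_exp_neg_mul_norm_rpow_lt_top d hσ hζ.1).ne
  set S := ∑' n : Fin d → ℤ, ENNReal.ofReal (Real.exp (-σ * ‖pt n‖ ^ ζ)) with hSdef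
  set C := max C₀ 0 with hC
  refine ⟨C ^ 2 * Real.exp σ * S.toReal, fun u => iSup_le fun t => ?_⟩
  have hw : ∀ x : Fin d → ℤ, ∀ y ∈ box x, Real.exp (σ * ‖y - pt u‖ ^ ζ) ≤
      Real.exp (σ * (‖pt x - pt u‖ ^ ζ + 1)) := fun x y hy => by
    gcongr
    exact norm_sub_pt_rpow_le hy hζ
  rw [moment]
  refine (weightedHSSq_le_tsum hμ hw _).trans ?_
  have hterm : ∀ x : Fin d → ℤ, ENNReal.ofReal (Real.exp (σ * (‖pt x - pt u‖ ^ ζ + 1))) *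
      hsNorm (chi μ x ∘L evol H X t ∘L chi μ u) ^ 2 ≤
      ENNReal.ofReal (C ^ 2 * Real.exp σ * Real.exp (ε * ‖pt u‖ ^ ζ)) *
        ENNReal.ofReal (Real.exp (-σ * ‖pt x - pt u‖ ^ ζ)) := by
    intro x
    have h1 : hsNorm (chi μ x ∘L evol H X t ∘L chi μ u) ≤ ENNReal.ofReal
        (C * Real.exp (ε / 2 * ‖pt u‖ ^ ζ) * Real.exp (-σ * ‖pt x - pt u‖ ^ ζ)) := by
      refine ((le_iSup (fun t : ℝ => hsNorm (chi μ x ∘L evol H X t ∘L chi μ u)) t).trans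
        (hC₀ x u)).trans (ENNReal.ofReal_le_ofReal ?_)
      gcongr
      exact le_max_left _ _
    refine (mul_le_mul_right (pow_le_pow_left' h1 2) _).trans_eq ?_
    rw [← ENNReal.ofReal_pow (by positivity), ← ENNReal.ofReal_mul (by positivity),
      ← ENNReal.ofReal_mul (by positivity)]
    congr 1
    rw [mul_pow, mul_pow, ← Real.exp_nat_mul, ← Real.exp_nat_mul]
    have e1 : Real.exp (σ * (‖pt x - pt u‖ ^ ζ + 1)) * Real.exp ((2 : ℕ) *
        (-σ * ‖pt x - pt u‖ ^ ζ)) = Real.exp σ * Real.exp (-σ * ‖pt x - pt u‖ ^ ζ) := by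
      rw [← Real.exp_add, ← Real.exp_add]
      congr 1
      push_cast
      ring
    have e2 : Real.exp ((2 : ℕ) * (ε / 2 * ‖pt u‖ ^ ζ)) = Real.exp (ε * ‖pt u‖ ^ ζ) := by
      congr 1
      push_cast
      ring
    rw [e2]
    linear_combination (C ^ 2 * Real.exp (ε * ‖pt u‖ ^ ζ)) * e1
  refine (ENNReal.tsum_le_tsum hterm).trans_eq ?_
  rw [ENNReal.tsum_mul_left, tsum_exp_neg_mul_norm_sub_rpow, ← hSdef,
    ← ENNReal.ofReal_toReal hS, ENNReal.toReal_ofReal ENNReal.toReal_nonneg,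
    ← ENNReal.ofReal_mul (by positivity)]
  congr 1
  ring

theorem lintegral_exp_neg_div {T : ℝ} (hT : 0 < T) :
    ∫⁻ t in Set.Ici (0 : ℝ), ENNReal.ofReal (Real.exp (-t / T)) = ENNReal.ofReal T := by
  have h1 : ∀ t : ℝ, Real.exp (-t / T) = Real.exp (-(1 / T) * t) := fun t => by
    congr 1
    ring
  have hneg : -(1 / T) < 0 := neg_neg_of_pos (by positivity)
  rw [setLIntegral_congr Ioi_ae_eq_Ici.symm]
  simp only [h1]
  rw [← ofReal_integral_eq_lintegral_ofReal (integrableOn_exp_mul_Ioi hneg 0)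
    (Filter.Eventually.of_forall fun _ => (Real.exp_pos _).le), integral_exp_mul_Ioi hneg]
  simp

theorem UniformMomentBound.abelMomentBound (h : UniformMomentBound μ H I) :
    AbelMomentBound μ H I := by
  obtain ⟨σ, hσ, ζ, hζ, h⟩ := h
  refine ⟨σ, hσ, ζ, hζ, fun ε hε X hX => ?_⟩
  obtain ⟨C, hC⟩ := h ε hε X hX
  refine ⟨C, fun u => iSup_le fun T => ?_⟩
  have hT : (0 : ℝ) < T := T.2
  set B := ENNReal.ofReal (C * Real.exp (ε * ‖pt u‖ ^ ζ)) with hB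
  calc _ ≤ ENNReal.ofReal (1 / T) *
        ∫⁻ t in Set.Ici (0 : ℝ), ENNReal.ofReal (Real.exp (-t / T)) * B := by
        gcongr with t
        exact (le_iSup (fun t => moment μ H u σ ζ X t) t).trans (hC u)
    _ = B := by
        rw [lintegral_mul_const' _ _ ENNReal.ofReal_ne_top, lintegral_exp_neg_div hT, ← mul_assoc,
          ← ENNReal.ofReal_mul (by positivity), one_div_mul_cancel hT.ne', ENNReal.ofReal_one,
          one_mul]

/-- On [0, T] the indicator is at most e · e^{-t/T}, whence the factor e in the constant. -/
theorem AbelMomentBound.averagedMomentBound (h : AbelMomentBound μ H I) :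
    AveragedMomentBound μ H I := by
  obtain ⟨σ, hσ, ζ, hζ, h⟩ := h
  refine ⟨σ, hσ, ζ, hζ, fun ε hε X hX => ?_⟩
  obtain ⟨C, hC⟩ := h ε hε X hX
  refine ⟨Real.exp 1 * C, fun u => iSup_le fun T => ?_⟩
  have hT : (0 : ℝ) < T := T.2
  calc _ ≤ ENNReal.ofReal (1 / T) * ∫⁻ t in Set.Icc (0 : ℝ) T, ENNReal.ofReal (Real.exp 1) *
        (ENNReal.ofReal (Real.exp (-t / T)) * moment μ H u σ ζ X t) := by
        refine mul_le_mul_right (setLIntegral_mono' measurableSet_Icc fun t ht => ?_) _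
        rw [← mul_assoc, ← ENNReal.ofReal_mul (by positivity), ← Real.exp_add]
        refine le_mul_of_one_le_left zero_le ?_
        rw [← ENNReal.ofReal_one]
        refine ENNReal.ofReal_le_ofReal (Real.one_le_exp ?_)
        have : t / T ≤ 1 := (div_le_one hT).mpr ht.2
        rw [neg_div]
        linarith
    _ ≤ ENNReal.ofReal (1 / T) * ∫⁻ t in Set.Ici (0 : ℝ), ENNReal.ofReal (Real.exp 1) *
        (ENNReal.ofReal (Real.exp (-t / T)) * moment μ H u σ ζ X t) := by
        gcongr
        exact Set.Icc_subset_Ici_self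
    _ = ENNReal.ofReal (Real.exp 1) * (ENNReal.ofReal (1 / T) * ∫⁻ t in Set.Ici (0 : ℝ),
        ENNReal.ofReal (Real.exp (-t / T)) * moment μ H u σ ζ X t) := by
        rw [lintegral_const_mul' _ _ ENNReal.ofReal_ne_top]
        ring
    _ ≤ ENNReal.ofReal (Real.exp 1) * ENNReal.ofReal (C * Real.exp (ε * ‖pt u‖ ^ ζ)) := by
        gcongr
        exact (le_iSup (fun T : Set.Ioi (0 : ℝ) => ENNReal.ofReal (1 / T) *
          ∫⁻ t in Set.Ici (0 : ℝ), ENNReal.ofReal (Real.exp (-t / T)) *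
            moment μ H u σ ζ X t) T).trans (hC u)
    _ = _ := by
        rw [← ENNReal.ofReal_mul (by positivity), mul_assoc]

end Localization

/-! ### Time averages of almost periodic functions. -/

section Averaging

theorem exists_integral_re_exp_ge {ω : ℝ} (hω : ω ≠ 0) (a : ℂ) :
    ∃ K : ℝ, ∀ T : ℝ, -K ≤ ∫ t in (0 : ℝ)..T, (Complex.exp (Complex.I * ω * t) * a).re := by
  have hc : Complex.I * (ω : ℂ) ≠ 0 := mul_ne_zero Complex.I_ne_zero (by exact_mod_cast hω)
  refine ⟨2 / |ω| * ‖a‖, fun T => ?_⟩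
  have hint : IntervalIntegrable (fun t : ℝ => Complex.exp (Complex.I * ω * t) * a) volume 0 T :=
    Continuous.intervalIntegrable (by fun_prop) _ _
  have h1 : ∫ t in (0 : ℝ)..T, (Complex.exp (Complex.I * ω * t) * a).re =
      (∫ t in (0 : ℝ)..T, Complex.exp (Complex.I * ω * t) * a).re :=
    (Complex.reCLM.intervalIntegral_comp_comm hint)
  have h2 : ∀ s : ℝ, ‖Complex.exp (Complex.I * ω * s)‖ = 1 := fun s => by
    rw [Complex.norm_exp]
    simp
  rw [h1, intervalIntegral.integral_mul_const, integral_exp_mul_complex hc]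
  refine (abs_le.mp ((Complex.abs_re_le_norm _).trans ?_)).1
  rw [norm_mul, norm_div, norm_mul, Complex.norm_I, one_mul, Complex.norm_real, Real.norm_eq_abs]
  gcongr
  refine (norm_sub_le _ _).trans ?_
  rw [h2, h2]
  norm_num

/-- Time averages of an absolutely convergent trigonometric series single out the coefficient of
frequency zero. -/
theorem exists_continuous_le_re_of_hasSum {a : ℝ → ℂ} {φ : ℝ → ℂ}
    {lam : ℝ} (hφ : ∀ t : ℝ, HasSum (fun l : ℝ => Complex.exp (Complex.I * (lam - l : ℝ) * t) * a l)
      (φ t)) {δ : ℝ} (hδ : 0 < δ) :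
    ∃ p : ℝ → ℝ, Continuous p ∧ (∃ K : ℝ, ∀ T : ℝ, -K ≤ ∫ t in (0 : ℝ)..T, p t) ∧
      ∀ t, (a lam).re - δ + p t ≤ (φ t).re := by
  classical
  have hnorm : ∀ t l : ℝ, ‖Complex.exp (Complex.I * (lam - l : ℝ) * t) * a l‖ = ‖a l‖ := by
    intro t l
    rw [norm_mul, Complex.norm_exp]
    simp
  -- Unconditional convergence of a scalar series is absolute, so t = 0 already controls the tails
  -- uniformly in t.
  have hsum : Summable fun l => ‖a l‖ := by
    have := (hφ 0).summable.norm
    simpa using this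
  obtain ⟨s, hs⟩ := summable_iff_vanishing_norm.mp hsum δ hδ
  -- Without lam all the frequencies lam - l are nonzero, and each oscillating integral is bounded
  -- below uniformly in T.
  set s' := s.erase lam
  choose! K hK using fun (l : ℝ) (hl : l ∈ s') =>
    exists_integral_re_exp_ge (ω := lam - l) (sub_ne_zero.mpr (Finset.ne_of_mem_erase hl).symm)
      (a l)
  refine ⟨fun t => ∑ l ∈ s', (Complex.exp (Complex.I * (lam - l : ℝ) * t) * a l).re, ?_,
    ⟨∑ l ∈ s', K l, fun T => ?_⟩, fun t => ?_⟩
  · refine continuous_finsetSum _ fun l _ => Complex.continuous_re.comp ?_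
    fun_prop
  · rw [intervalIntegral.integral_finsetSum, ← Finset.sum_neg_distrib]
    · exact Finset.sum_le_sum fun l hl => hK l hl T
    · intro l _
      refine Continuous.intervalIntegrable (Complex.continuous_re.comp ?_) _ _
      fun_prop
  · set c : ℝ → ℂ := fun l => Complex.exp (Complex.I * (lam - l : ℝ) * t) * a l with hc
    have hclam : c lam = a lam := by simp [hc]
    have htend : Filter.Tendsto (fun F : Finset ℝ => (∑ l ∈ F, c l).re) Filter.atTop
        (nhds (φ t).re) := (Complex.continuous_re.tendsto _).comp (hφ t)
    refine ge_of_tendsto htend ?_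
    filter_upwards [Filter.eventually_ge_atTop (insert lam s)] with F hF
    have hsub : insert lam s' ⊆ F := by
      refine (Finset.insert_subset_insert _ (Finset.erase_subset _ _)).trans hF
    rw [← Finset.sum_sdiff hsub, Finset.sum_insert (Finset.notMem_erase _ _), Complex.add_re,
      Complex.add_re, hclam, Complex.re_sum s']
    have htail : |(∑ l ∈ F \ insert lam s', c l).re| ≤ δ := by
      have hdisj : Disjoint (F \ insert lam s') s := by
        rw [Finset.disjoint_left]
        intro l hl hls
        rw [Finset.mem_sdiff, Finset.mem_insert, not_or] at hl
        exact hl.2.2 (Finset.mem_erase.mpr ⟨hl.2.1, hls⟩)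
      have h1 := hs _ hdisj
      rw [Real.norm_of_nonneg (Finset.sum_nonneg fun _ _ => norm_nonneg _)] at h1
      refine (Complex.abs_re_le_norm _).trans ((norm_sum_le _ _).trans ?_)
      simp only [hc, hnorm]
      exact h1.le
    have := (abs_le.mp htail).1
    linarith

open scoped InnerProductSpace in
-- The vectors g l need not be orthogonal. Pairing with g lam reduces to the scalar series, whose
-- zero-frequency coefficient is ‖g lam‖², and 2 ‖g lam‖ ‖v‖ ≤ ‖g lam‖² + ‖v‖² converts the pairing
-- into a lower bound for ‖v‖².
theorem exists_continuous_le_norm_sq_of_hasSum {F : Type*} [NormedAddCommGroup F]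
    [InnerProductSpace ℂ F] {g : ℝ → F} {v : ℝ → F} (lam : ℝ)
    (hv : ∀ t : ℝ, HasSum (fun l : ℝ => Complex.exp (-(Complex.I * t * l)) • g l) (v t))
    {δ : ℝ} (hδ : 0 < δ) :
    ∃ p : ℝ → ℝ, Continuous p ∧ (∃ K : ℝ, ∀ T : ℝ, -K ≤ ∫ t in (0 : ℝ)..T, p t) ∧
      ∀ t, ‖g lam‖ ^ 2 - δ + p t ≤ ‖v t‖ ^ 2 := by
  obtain ⟨p, hp, ⟨K, hK⟩, hle⟩ := exists_continuous_le_re_of_hasSum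
    (a := fun l => ⟪g lam, g l⟫_ℂ) (φ := fun t => ⟪g lam, Complex.exp (Complex.I * lam * t) • v t⟫_ℂ)
    (lam := lam) (fun t => by
      have h := ((hv t).const_smul (Complex.exp (Complex.I * lam * t))).mapL (innerSL ℂ (g lam))
      refine (congrArg (HasSum · _) (funext fun l => ?_)).mpr h
      rw [smul_smul, ← Complex.exp_add, innerSL_apply_apply, inner_smul_right]
      congr 2
      push_cast
      ring) (half_pos hδ)
  refine ⟨fun t => 2 * p t, by fun_prop, ⟨2 * K, fun T => ?_⟩, fun t => ?_⟩
  · rw [intervalIntegral.integral_const_mul]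
    linarith [hK T]
  · have h1 := hle t
    have h2 : (⟪g lam, g lam⟫_ℂ).re = ‖g lam‖ ^ 2 := by
      rw [inner_self_eq_norm_sq_to_K]
      norm_cast
    rw [h2] at h1
    have h3 := re_inner_le_norm (𝕜 := ℂ) (g lam) (Complex.exp (Complex.I * lam * t) • v t)
    have h4 : ‖Complex.exp (Complex.I * lam * t)‖ = 1 := by
      rw [Complex.norm_exp]
      simp
    rw [norm_smul, h4, one_mul] at h3
    have h5 : (⟪g lam, Complex.exp (Complex.I * lam * t) • v t⟫_ℂ).re ≤ ‖g lam‖ * ‖v t‖ := h3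
    nlinarith [sq_nonneg (‖g lam‖ - ‖v t‖)]

theorem le_of_average_le {b B δ : ℝ} (hδ : 0 < δ) (hB : 0 ≤ B) {p : ℝ → ℝ} (hp : Continuous p)
    {K : ℝ} (hK : ∀ T : ℝ, -K ≤ ∫ t in (0 : ℝ)..T, p t) {m : ℝ → ℝ≥0∞}
    (hm : ∀ t, ENNReal.ofReal (b + p t) ≤ m t)
    (hav : ∀ T : ℝ, 0 < T → ENNReal.ofReal (1 / T) * ∫⁻ t in Set.Icc (0 : ℝ) T, m t ≤
      ENNReal.ofReal B) : b ≤ B + δ := by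
  -- One time suffices: K/T ≤ δ makes the oscillating part negligible, and the maximum with 1 keeps
  -- T positive.
  set T := max (K / δ) 1 with hT
  have hT0 : 0 < T := lt_max_of_lt_right one_pos
  have hKT : K ≤ T * δ := by
    rw [← div_le_iff₀ hδ]
    exact le_max_left _ _
  -- Clipping at zero matches `ENNReal.ofReal` and only increases the integral.
  set h : ℝ → ℝ := fun t => max (b + p t) 0 with hh
  have hcont : Continuous h := by fun_prop
  have h1 : ∫ t in (0 : ℝ)..T, (b + p t) ≤ ∫ t in (0 : ℝ)..T, h t :=
    intervalIntegral.integral_mono hT0.le (Continuous.intervalIntegrable (by fun_prop) _ _)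
      (hcont.intervalIntegrable _ _) fun t => le_max_left _ _
  rw [intervalIntegral.integral_add (by simp) (hp.intervalIntegrable _ _)] at h1
  simp only [intervalIntegral.integral_const, sub_zero, smul_eq_mul] at h1
  have h2 : ENNReal.ofReal (∫ t in (0 : ℝ)..T, h t) ≤ ∫⁻ t in Set.Icc (0 : ℝ) T, m t := by
    rw [intervalIntegral.integral_of_le hT0.le, ← integral_Icc_eq_integral_Ioc,
      ofReal_integral_eq_lintegral_ofReal hcont.integrableOn_Icc
        (Filter.Eventually.of_forall fun t => le_max_right _ _)]
    refine lintegral_mono fun t => ?_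
    refine le_trans (le_of_eq ?_) (hm t)
    simp [hh]
  have h3 : ENNReal.ofReal (1 / T * ∫ t in (0 : ℝ)..T, h t) ≤ ENNReal.ofReal B := by
    rw [ENNReal.ofReal_mul (by positivity)]
    exact (mul_le_mul_right h2 _).trans (hav T hT0)
  rw [ENNReal.ofReal_le_ofReal_iff hB, one_div, inv_mul_le_iff₀ hT0] at h3
  have h4 := hK T
  have h5 : T * b ≤ T * (B + δ) := by nlinarith
  exact le_of_mul_le_mul_left h5 hT0

end Averaging

/-! ### From averaged moments back to SULP. -/

section Localization

variable {d : ℕ} {μ : Measure (Fin d → ℝ)} {H : L2 μ →ₗ.[ℂ] L2 μ} {I : Set ℝ}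

theorem hsNorm_eigenProj_sq_le_of_average (hH : IsSelfAdjoint H) (hpp : HasPurePointSpectrumIn H I)
    {X : ℝ → ℝ} (hX : X ∈ TestFun I) {x u : Fin d → ℤ} {B : ℝ} (hB : 0 ≤ B)
    (hav : ∀ T : ℝ, 0 < T → ENNReal.ofReal (1 / T) * ∫⁻ t in Set.Icc (0 : ℝ) T,
      hsNorm (chi μ x ∘L evol H X t ∘L chi μ u) ^ 2 ≤ ENNReal.ofReal B) (lam : ℝ) :
    (ENNReal.ofReal (X lam) * hsNorm (chi μ x ∘L eigenProj H lam ∘L chi μ u)) ^ 2 ≤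
      ENNReal.ofReal B := by
  have hX0 := hX.2.2.2
  set b := basis (L2 μ)
  set g : basisIndex (L2 μ) → ℝ → L2 μ := fun i l =>
    (X l : ℂ) • (chi μ x ∘L eigenProj H l ∘L chi μ u) (b i) with hg
  set v : basisIndex (L2 μ) → ℝ → L2 μ := fun i t =>
    (chi μ x ∘L evol H X t ∘L chi μ u) (b i) with hv
  have hsum : ∀ i, ∀ t : ℝ, HasSum (fun l : ℝ => Complex.exp (-(Complex.I * t * l)) • g i l)
      (v i t) := fun i t => by
    have := (hasSum_evol_apply hH hpp hX t (chi μ u (b i))).mapL (chi μ x)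
    simpa only [hg, hv, map_smul, smul_smul, ContinuousLinearMap.comp_apply] using this
  have hleft : (ENNReal.ofReal (X lam) * hsNorm (chi μ x ∘L eigenProj H lam ∘L chi μ u)) ^ 2 =
      ∑' i, ‖g i lam‖ₑ ^ 2 := by
    rw [mul_pow, hsNorm_sq, ← ENNReal.tsum_mul_left]
    refine tsum_congr fun i => ?_
    rw [hg, enorm_smul, mul_pow, ← ofReal_norm (X lam : ℂ), Complex.norm_real,
      Real.norm_of_nonneg (hX0 lam)]
  rw [hleft, ENNReal.tsum_eq_iSup_sum]
  refine iSup_le fun s => ?_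
  have hconv : ∀ w : basisIndex (L2 μ) → L2 μ,
      ∑ i ∈ s, ‖w i‖ₑ ^ 2 = ENNReal.ofReal (∑ i ∈ s, ‖w i‖ ^ 2) := fun w => by
    rw [ENNReal.ofReal_sum_of_nonneg fun _ _ => sq_nonneg _]
    refine Finset.sum_congr rfl fun i _ => ?_
    rw [ENNReal.ofReal_pow (norm_nonneg _), ofReal_norm]
  rw [hconv fun i => g i lam]
  refine ENNReal.ofReal_le_ofReal (le_of_forall_pos_le_add fun δ hδ => ?_)
  -- The error δ/2 is divided among the basis vectors in s, with + 1 covering the empty set; the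
  -- other δ/2 goes to the time average.
  set η := δ / 2 / (s.card + 1) with hη
  have hη0 : 0 < η := by positivity
  choose p hp hK hle using fun i => exists_continuous_le_norm_sq_of_hasSum lam (hsum i) hη0
  choose K hK using hK
  have hηs : s.card * η ≤ δ / 2 := by
    rw [hη, mul_div_assoc', div_le_iff₀ (by positivity)]
    nlinarith
  have hb := le_of_average_le (b := ∑ i ∈ s, ‖g i lam‖ ^ 2 - s.card * η) (half_pos hδ) hB
    (p := fun t => ∑ i ∈ s, p i t) (continuous_finsetSum _ fun i _ => hp i)
    (K := ∑ i ∈ s, K i) (fun T => by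
      rw [intervalIntegral.integral_finsetSum fun i _ => (hp i).intervalIntegrable _ _,
        ← Finset.sum_neg_distrib]
      exact Finset.sum_le_sum fun i _ => hK i T)
    (m := fun t => hsNorm (chi μ x ∘L evol H X t ∘L chi μ u) ^ 2) (fun t => by
      have h1 : ∑ i ∈ s, ‖g i lam‖ ^ 2 - s.card * η + ∑ i ∈ s, p i t ≤ ∑ i ∈ s, ‖v i t‖ ^ 2 := by
        have := Finset.sum_le_sum fun i (_ : i ∈ s) => hle i t
        simpa only [Finset.sum_add_distrib, Finset.sum_sub_distrib, Finset.sum_const,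
          nsmul_eq_mul] using this
      refine (ENNReal.ofReal_le_ofReal h1).trans ?_
      rw [← hconv, hsNorm_sq]
      exact ENNReal.sum_le_tsum s) hav
  linarith

theorem AveragedMomentBound.sulp (hH : IsSelfAdjoint H) (hpp : HasPurePointSpectrumIn H I)
    (h : AveragedMomentBound μ H I) : SULP μ H I := by
  obtain ⟨σ, hσ, ζ, hζ, h⟩ := h
  refine ⟨ζ, hζ, σ / 2, by positivity, fun ε hε X hX => ?_⟩
  obtain ⟨C₀, hC₀⟩ := h (2 * ε) (by positivity) X hX
  set C := max C₀ 0 with hC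
  have hC0 : 0 ≤ C := le_max_right _ _
  -- The moment is quadratic, hence the square root, the rate σ/2 and the use of 2ε above. The
  -- factor e^σ pays for replacing a point of the box by its centre.
  refine ⟨Real.sqrt (Real.exp σ * C), fun x u => iSup_le fun lam => ?_⟩
  rw [← ENNReal.pow_le_pow_left_iff two_ne_zero, ← ENNReal.ofReal_pow (by positivity), mul_pow,
    mul_pow, mul_pow, Real.sq_sqrt (by positivity), ← Real.exp_nat_mul, ← Real.exp_nat_mul, ← mul_pow]
  have hw : ∀ y ∈ box x, Real.exp (σ * (‖pt x - pt u‖ ^ ζ - 1)) ≤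
      Real.exp (σ * ‖y - pt u‖ ^ ζ) := fun y hy => by
    gcongr
    linarith [norm_pt_sub_rpow_le (u := u) hy hζ]
  have hm : ∀ t, hsNorm (chi μ x ∘L evol H X t ∘L chi μ u) ^ 2 ≤
      ENNReal.ofReal (Real.exp (-(σ * (‖pt x - pt u‖ ^ ζ - 1)))) * moment μ H u σ ζ X t := by
    intro t
    have h1 := mul_hsNorm_le_weightedHSSq hw (evol H X t ∘L chi μ u)
    calc _ = ENNReal.ofReal (Real.exp (-(σ * (‖pt x - pt u‖ ^ ζ - 1)))) *
          (ENNReal.ofReal (Real.exp (σ * (‖pt x - pt u‖ ^ ζ - 1))) *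
            hsNorm (chi μ x ∘L evol H X t ∘L chi μ u) ^ 2) := by
          rw [← mul_assoc, ← ENNReal.ofReal_mul (by positivity), ← Real.exp_add]
          simp
      _ ≤ _ := by
          gcongr
          exact h1
  refine hsNorm_eigenProj_sq_le_of_average hH hpp hX (by positivity) (fun T hT => ?_) lam
  have h2 : ENNReal.ofReal (1 / T) * ∫⁻ t in Set.Icc (0 : ℝ) T, moment μ H u σ ζ X t ≤
      ENNReal.ofReal (C * Real.exp (2 * ε * ‖pt u‖ ^ ζ)) := by
    refine ((le_iSup (fun T : Set.Ioi (0 : ℝ) => ENNReal.ofReal (1 / T) *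
      ∫⁻ t in Set.Icc (0 : ℝ) T, moment μ H u σ ζ X t) ⟨T, hT⟩).trans (hC₀ u)).trans
      (ENNReal.ofReal_le_ofReal ?_)
    gcongr
    exact le_max_left _ _
  calc _ ≤ ENNReal.ofReal (1 / T) * ∫⁻ t in Set.Icc (0 : ℝ) T,
        ENNReal.ofReal (Real.exp (-(σ * (‖pt x - pt u‖ ^ ζ - 1)))) * moment μ H u σ ζ X t :=
        mul_le_mul_right (lintegral_mono hm) _
    _ = ENNReal.ofReal (Real.exp (-(σ * (‖pt x - pt u‖ ^ ζ - 1)))) *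
        (ENNReal.ofReal (1 / T) * ∫⁻ t in Set.Icc (0 : ℝ) T, moment μ H u σ ζ X t) := by
        rw [lintegral_const_mul' _ _ ENNReal.ofReal_ne_top]
        ring
    _ ≤ ENNReal.ofReal (Real.exp (-(σ * (‖pt x - pt u‖ ^ ζ - 1)))) *
        ENNReal.ofReal (C * Real.exp (2 * ε * ‖pt u‖ ^ ζ)) := by gcongr
    _ = _ := by
        rw [← ENNReal.ofReal_mul (by positivity)]
        congr 1
        have e1 : Real.exp (-(σ * (‖pt x - pt u‖ ^ ζ - 1))) =
            Real.exp σ * Real.exp ((2 : ℕ) * (-(σ / 2) * ‖pt x - pt u‖ ^ ζ)) := by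
          rw [← Real.exp_add]
          congr 1
          push_cast
          ring
        have e2 : Real.exp ((2 : ℕ) * (ε * ‖pt u‖ ^ ζ)) = Real.exp (2 * ε * ‖pt u‖ ^ ζ) := by
          congr 1
          push_cast
          ring
        rw [e1, e2]
        ring

end Localization

end DynLoc

theorem theorem2p1 (d : ℕ) (μ : Measure (Fin d → ℝ))
    (hμ : μ = volume ∨ μ = DynLoc.latticeMeasure d)
    (H : DynLoc.L2 μ →ₗ.[ℂ] DynLoc.L2 μ) (hH : IsSelfAdjoint H)
    (I : Set ℝ) (hIo : IsOpen I) (hI : I.OrdConnected) (hIH : I ⊆ DynLoc.realSpectrum H)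
    (hpp : DynLoc.HasPurePointSpectrumIn H I)
    (hfin : μ = volume → DynLoc.LocallyTraceFinite μ H I) :
    [DynLoc.AveragedMomentBound μ H I,
      DynLoc.AbelMomentBound μ H I,
      DynLoc.UniformMomentBound μ H I,
      DynLoc.SUDL μ H I,
      DynLoc.SULP μ H I].TFAE := by
  tfae_have 5 → 4 := DynLoc.SULP.sudl hμ hH hpp hfin
  tfae_have 4 → 3 := DynLoc.SUDL.uniformMomentBound hμ
  tfae_have 3 → 2 := DynLoc.UniformMomentBound.abelMomentBound
  tfae_have 2 → 1 := DynLoc.AbelMomentBound.averagedMomentBound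
  tfae_have 1 → 5 := DynLoc.AveragedMomentBound.sulp hH hpp
  tfae_finish
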